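/- **Theorem (lower bound for general CAMDPs, strict feasibility).** *Setting.* A constrained average-reward MDP (CAMDP) with finite state space $\mathcal S$ and finite action space $\mathcal A$, $|\mathcal S|=S$, $|\mathcal A|=A$, consists of a transition kernel $P(\cdot\mid s,a)$, a reward $r$ and a constraint reward $c$ with values in $[0,1]$, a threshold $b\in\mathbb R$ and an initial distribution $\mu$. For a stationary randomized policy $\pi$ and $f\in\{r,c\}$ let $\rho_f^\pi(s)=\lim_{T\to\infty}\frac1T\mathbb E_s^\pi\big[\sum_{t<T}f(s_t,a_t)\big]$, let $\rho_f^\pi=\sum_s\mu(s)\rho_f^\pi(s)$, and let the bias $h_f^\pi(s)$ be the Cesàro limit, as $T\to\infty$, of $\mathbb E_s^\pi\big[\sum_{t<T}(f(s_t,a_t)-\rho_f^\pi(s_t))\big]$. A mixture $\hat\pi$ of (at most countably many) stationary policies draws one of them at time $0$ and follows it forever; $\rho_f^{\hat\pi}$ is the corresponding average. Let $\mathcal C(S,A,B,H,\zeta)$ be the set of CAMDPs with $S$ states and $A$ actions such that * for every deterministic stationary policy and every starting state, the expected hitting time of the set of recurrent states is at most $B$; * $\max_s h_f^\pi(s)-\min_s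 h_f^\pi(s)\le H$ for every stationary policy $\pi$ and $f\in\{r,c\}$; * the Slater constant $\max_\pi\rho_c^\pi-b$, the maximum being over stationary policies, equals $\zeta$. A sampling algorithm knows $(\mathcal S,\mathcal A,r,c,b,\mu)$ and all of $S,A,B,H,\zeta,\epsilon$, but not $P$. It adaptively, possibly with randomization, queries a generative model that answers a query $(s,a)$ by an independent draw from $P(\cdot\mid s,a)$; it decides when to stop, and then returns a mixture of stationary policies. A mixture $\hat\pi$ is a *strictly feasible $\eta$-optimal* policy if $\rho_c^{\hat\pi}\ge b$ and $\rho_r^{\hat\pi}\ge\rho_r^{\pi}-\eta$ for every stationary policy $\pi$ with $\rho_c^\pi\ge b$. *Claim.* There are universal constants $\kappa,\epsilon_0>0$ and $N_0\in\mathbb N$ such that the following holds for all integers $S,A\ge N_0$ and all real $B,H\ge N_0$, $\zeta\in(0,1]$ and $\epsilon\in(0,\epsilon_0]$ with $\epsilon\zeta B\le H$. For every sampling algorithm that, on every CAMDP in $\mathcal C(S,A,B,H,\zeta)$, returns with probability at least $3/4$ a strictly feasible $\frac{\epsilon}{24}$-optimal policy, there is a CAMDP in $\mathcal C(S,A,B,H,\zeta)$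 on which its expected total number of samples, over all state-action pairs, is at least $$\kappa\,\frac{SA(B+H)}{\epsilon^2\zeta^2}.$$ -/

import Mathlib

open Filter Topology

/-- The known part of a constrained average-reward MDP: the reward `r`, the constraint reward `c`,
the constraint threshold `b` and the initial state distribution. -/
structure CTask (S A : Type) where
  r : S → A → ℝ
  c : S → A → ℝ
  b : ℝ
  init : PMF S
  r_mem : ∀ s a, r s a ∈ Set.Icc (0 : ℝ) 1
  c_mem : ∀ s a, c s a ∈ Set.Icc (0 : ℝ) 1

/-- A constrained average-reward MDP: a task together with its (unknown) transition kernel `P`. -/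
structure CAMDP (S A : Type) extends CTask S A where
  P : S → A → PMF S

/-- Stationary randomized policies. -/
abbrev StatPolicy (S A : Type) : Type := S → PMF A

/-- Mixtures of stationary policies: a stationary policy is drawn at time `0` and then followed
forever. A single stationary policy is the mixture `PMF.pure π`. -/
abbrev MixedPolicy (S A : Type) : Type := PMF (StatPolicy S A)

noncomputable section

section MarkovChain

variable {S A : Type} [Fintype S] [DecidableEq S] [Fintype A]

/-- The transition matrix of the Markov chain that a stationary policy induces. -/
def chain (P : S → A → PMF S) (π : StatPolicy S A) : Matrix S S ℝ :=
  Matrix.of fun s s' => ∑ a, (π s a).toReal * (P s a s').toReal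

/-- The expected one-step reward in state `s` under a stationary policy. -/
def meanReward (f : S → A → ℝ) (π : StatPolicy S A) (s : S) : ℝ :=
  ∑ a, (π s a).toReal * f s a

/-- `E_s[f(s_t, a_t)]` under a stationary policy. -/
def rewardAt (P : S → A → PMF S) (f : S → A → ℝ) (π : StatPolicy S A) (t : ℕ) (s : S) : ℝ :=
  ((chain P π ^ t).mulVec (meanReward f π)) s

/-- The gain (long-run average reward) from state `s`: the limit of
`(1/T) E_s[∑_{t<T} f(s_t, a_t)]`. The limit exists for every finite chain. -/
def gain (P : S → A → PMF S) (f : S → A → ℝ) (π : StatPolicy S A) (s : S) : ℝ :=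
  limUnder atTop fun T : ℕ => (∑ t ∈ Finset.range T, rewardAt P f π t s) / T

/-- `E_s[∑_{t<T} (f(s_t, a_t) - gain(s_t))]`. -/
def centeredSum (P : S → A → PMF S) (f : S → A → ℝ) (π : StatPolicy S A) (T : ℕ) (s : S) : ℝ :=
  ∑ t ∈ Finset.range T,
    (rewardAt P f π t s - ((chain P π ^ t).mulVec (gain P f π)) s)

/-- The bias: the Cesàro limit, as `T → ∞`, of the centered sums.
The limit exists for every finite chain. -/
def bias (P : S → A → PMF S) (f : S → A → ℝ) (π : StatPolicy S A) (s : S) : ℝ :=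
  limUnder atTop fun N : ℕ => (∑ T ∈ Finset.range N, centeredSum P f π T s) / N

/-- `s'` can be reached from `s` in some number of steps of the chain `Q`. -/
def Reaches (Q : Matrix S S ℝ) (s s' : S) : Prop := ∃ n : ℕ, 0 < (Q ^ n) s s'

/-- Recurrent states of a finite chain: every state that can be reached from `s` leads back
to `s`. -/
def IsRecurrent (Q : Matrix S S ℝ) (s : S) : Prop := ∀ s', Reaches Q s s' → Reaches Q s' s

open Classical in
/-- The probability, started in `s`, that none of the states at times `0, …, t` is recurrent,
that is `P_s(T > t)` for the first hitting time `T` of the set of recurrent states. -/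
def surviveProb (Q : Matrix S S ℝ) : ℕ → S → ℝ
  | 0, s => if IsRecurrent Q s then 0 else 1
  | t + 1, s => if IsRecurrent Q s then 0 else ∑ s', Q s s' * surviveProb Q t s'

/-- `E_s[T] = ∑_{t ≥ 0} P_s(T > t)` for the first hitting time `T` of the recurrent states. -/
def expectedTransientTime (Q : Matrix S S ℝ) (s : S) : ENNReal :=
  ∑' t : ℕ, ENNReal.ofReal (surviveProb Q t s)

/-- Bounded transient time property with parameter `B`, over all deterministic stationary
policies. -/
def BoundedTransientTime (P : S → A → PMF S) (B : ℝ) : Prop :=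
  ∀ (d : S → A) (s : S),
    expectedTransientTime (chain P fun x => PMF.pure (d x)) s ≤ ENNReal.ofReal B

/-- The span of the bias function of every stationary policy is at most `H`. -/
def BiasSpanBounded (P : S → A → PMF S) (f : S → A → ℝ) (H : ℝ) : Prop :=
  ∀ (π : StatPolicy S A) (s s' : S), bias P f π s - bias P f π s' ≤ H

end MarkovChain

namespace CAMDP

variable {S A : Type} [Fintype S] [DecidableEq S] [Fintype A]

/-- Average reward of a stationary policy from the initial distribution. -/
def valueR (M : CAMDP S A) (π : StatPolicy S A) : ℝ :=
  ∑ s, (M.init s).toReal * gain M.P M.r π s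

/-- Average constraint reward of a stationary policy from the initial distribution. -/
def valueC (M : CAMDP S A) (π : StatPolicy S A) : ℝ :=
  ∑ s, (M.init s).toReal * gain M.P M.c π s

/-- Average reward of a mixture. -/
def mixedR (M : CAMDP S A) (w : MixedPolicy S A) : ℝ := ∑' π, (w π).toReal * M.valueR π

/-- Average constraint reward of a mixture. -/
def mixedC (M : CAMDP S A) (w : MixedPolicy S A) : ℝ := ∑' π, (w π).toReal * M.valueC π

/-- The Slater constant `max_π ρ_c^π - b` equals `ζ`. -/
def HasSlater (M : CAMDP S A) (ζ : ℝ) : Prop :=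
  IsGreatest (Set.range fun π : StatPolicy S A => M.valueC π - M.b) ζ

/-- The mixtures that satisfy the constraint exactly and whose reward is within `η` of that of
every feasible stationary policy. -/
def strictlyOptimal (M : CAMDP S A) (η : ℝ) : Set (MixedPolicy S A) :=
  {w | M.b ≤ M.mixedC w ∧ ∀ π : StatPolicy S A, M.b ≤ M.valueC π → M.valueR π - η ≤ M.mixedR w}

/-- The CAMDPs with transient time bounded by `B`, with bias spans (for the reward and for the
constraint reward) bounded by `H`, and with Slater constant `ζ`. -/
def problemClass (S A : Type) [Fintype S] [DecidableEq S] [Fintype A] (B H ζ : ℝ) :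
    Set (CAMDP S A) :=
  {M | BoundedTransientTime M.P B ∧ BiasSpanBounded M.P M.r H ∧ BiasSpanBounded M.P M.c H ∧
    M.HasSlater ζ}

end CAMDP

/-- A transcript of the interaction with the generative model: the triples
`(state, action, sampled next state)`, most recent first. -/
abbrev Transcript (S A : Type) : Type := List (S × A × S)

/-- An adaptive randomized sampling procedure: given the transcript so far, it either queries a
state-action pair or stops and returns a policy. -/
abbrev Sampler (S A : Type) : Type := Transcript S A → PMF ((S × A) ⊕ MixedPolicy S A)

namespace Sampler

variable {S A : Type}

/-- The probability that the run begins with the given transcript when queries of `(s, a)` are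
answered by independent draws from `P s a`. -/
def reachProb (alg : Sampler S A) (P : S → A → PMF S) : Transcript S A → ENNReal
  | [] => 1
  | (s, a, s') :: h => reachProb alg P h * alg h (Sum.inl (s, a)) * P s a s'

/-- The probability that the procedure stops and returns a policy in `G`. -/
def outputProb (alg : Sampler S A) (P : S → A → PMF S) (G : Set (MixedPolicy S A)) : ENNReal :=
  ∑' h : Transcript S A,
    alg.reachProb P h * ∑' w : MixedPolicy S A, G.indicator (fun w => alg h (Sum.inr w)) w

/-- The expected total number of queries over all state-action pairs: the sum over all
transcripts of the probability that the transcript occurs and is followed by another query. -/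
def expectedSamples (alg : Sampler S A) (P : S → A → PMF S) : ENNReal :=
  ∑' h : Transcript S A, alg.reachProb P h * ∑' q : S × A, alg h (Sum.inl q)

end Sampler

end

/-! The bound comes from hiding good actions. The states form `S / 4` independent components (plus
isolated absorbing states as filler): a decision state, left with probability `p = 32 / max B H`,
and three outcome states. All non-safe actions have the same outcome distribution, except that a
component may contain one hidden action that moves mass `δ = 32 * ε * ζ` from outcome `1` to outcome
`0`. A sample at a decision state carries information of order `p * δ ^ 2`, so finding the hidden
action takes about `A / (p * δ ^ 2)` samples per component, that is of order `A * (B + H) / (ε ^ 2 *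
ζ ^ 2)`.

Both structural parameters are served by one layout. If `H ≤ B`, the outcome states are absorbing:
the transient time is at most `1 / p ≤ B`, and since a decision state is paid the unperturbed
outcome value, the bias spans are at most `δ / p = ε * ζ * B ≤ H`. Otherwise outcome states return
with probability `p`: every state is recurrent and the biases are of order `1 / p`.

Strict feasibility brings in `ζ` (`Layout.exists_task`). For small `ζ`, not playing a hidden action
lowers the constraint value by order `δ`. The only remedy is the safe action, whose slack is about
`ζ`, so it must be played with probability of order `δ / ζ`, hence of order `ε`, and this costs
reward of order `ε`. An `ε / 24`-optimal feasible mixture therefore plays all but a fraction `1 /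
12` of the hidden actions. For large `ζ` the constraint is vacuous and the reward gain `δ` itself
has order `ε`.

The statistical part is `Sampler.two_mul_expect_le`, which compares a kernel with two opposite
perturbations of it and works directly with expected sample numbers, and `le_mul_of_loss_le`, which
averages over random patterns of hidden actions. The known task is the same for all patterns, so a
single sampler faces all of them. -/

noncomputable section

/-! ### Sums over transcripts -/

section ListSums

theorem ENNReal.tsum_sum_type {α β : Type*} (f : α ⊕ β → ENNReal) :
    ∑' x, f x = ∑' a, f (Sum.inl a) + ∑' b, f (Sum.inr b) :=
  Summable.tsum_sum ENNReal.summable ENNReal.summable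

/-- A list is either empty or has a head and a tail. -/
def listConsEquiv (α : Type*) : Unit ⊕ (α × List α) ≃ List α where
  toFun x := x.elim (fun _ => []) fun y => y.1 :: y.2
  invFun
    | [] => Sum.inl ()
    | x :: h => Sum.inr (x, h)
  left_inv := by rintro (_ | ⟨x, h⟩) <;> rfl
  right_inv := by rintro (_ | ⟨x, h⟩) <;> rfl

theorem tsum_list_cons {α : Type*} (f : List α → ENNReal) :
    ∑' h, f h = f [] + ∑' h, ∑' x, f (x :: h) := by
  rw [← (listConsEquiv α).tsum_eq, ENNReal.tsum_sum_type, ENNReal.tsum_comm, ← ENNReal.tsum_prod]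
  simp [listConsEquiv]

end ListSums

/-! ### Runs of a sampling procedure and the testing inequality -/

namespace Sampler

variable {S A : Type}

/-- The probability of stopping after a given transcript. -/
def stopProb (alg : Sampler S A) (h : Transcript S A) : ENNReal := ∑' w, alg h (Sum.inr w)

/-- The probability of another query after a given transcript. -/
def queryProb (alg : Sampler S A) (h : Transcript S A) : ENNReal := ∑' q, alg h (Sum.inl q)

theorem queryProb_add_stopProb (alg : Sampler S A) (h : Transcript S A) :
    alg.queryProb h + alg.stopProb h = 1 := by
  rw [queryProb, stopProb, ← ENNReal.tsum_sum_type, PMF.tsum_coe]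

/-- The expectation of a function of the returned policy, counted as `0` on runs that never
stop. -/
def expect (alg : Sampler S A) (P : S → A → PMF S) (F : MixedPolicy S A → ENNReal) : ENNReal :=
  ∑' h, alg.reachProb P h * ∑' w, alg h (Sum.inr w) * F w

/-- The expected number of queries of a given state-action pair. -/
def pairSamples (alg : Sampler S A) (P : S → A → PMF S) (q : S × A) : ENNReal :=
  ∑' h, alg.reachProb P h * alg h (Sum.inl q)

theorem tsum_triple {f : S × A × S → ENNReal} :
    ∑' x, f x = ∑' q : S × A, ∑' s' : S, f (q.1, q.2, s') := by
  rw [ENNReal.tsum_prod', ENNReal.tsum_prod']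
  refine tsum_congr fun s => ?_
  rw [ENNReal.tsum_prod']

theorem expectedSamples_eq_tsum (alg : Sampler S A) (P : S → A → PMF S) :
    alg.expectedSamples P = ∑' q, alg.pairSamples P q := by
  simp only [expectedSamples, pairSamples]
  rw [ENNReal.tsum_comm]
  simp only [ENNReal.tsum_mul_left]

theorem tsum_reachProb_cons (alg : Sampler S A) (P : S → A → PMF S) (h : Transcript S A) :
    ∑' x, alg.reachProb P (x :: h) = alg.reachProb P h * alg.queryProb h := by
  rw [tsum_triple]
  simp only [reachProb, queryProb]
  simp only [ENNReal.tsum_mul_left, PMF.tsum_coe, mul_one]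

/-- A potential that grows by at most `d x` with every sample `x` has, when the run stops, an
expectation of at most its initial value plus the expected total growth. -/
theorem tsum_reachProb_stopProb_le (alg : Sampler S A) (P : S → A → PMF S)
    (φ : Transcript S A → ENNReal) (d : S × A × S → ENNReal) (c : ENNReal) (hc : c ≠ ⊤)
    (hd : ∀ x, d x ≤ 1) (hnil : φ [] = c) (hcons : ∀ x h, φ (x :: h) = d x + φ h) :
    ∑' h, alg.reachProb P h * alg.stopProb h * φ h ≤
      c + ∑' h, ∑' x, alg.reachProb P (x :: h) * d x := by
  set R := alg.reachProb P
  have hRc : ∀ h, ∑' x, R (x :: h) = R h * alg.queryProb h := alg.tsum_reachProb_cons P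
  -- Truncating at length `k` makes all sums finite, so that a common term can be cancelled in
  -- `ENNReal`; the truncation is removed by monotone convergence.
  let F : ℕ → Transcript S A → ENNReal := fun k h => if h.length ≤ k then R h else 0
  have hFcons : ∀ k x h, F (k + 1) (x :: h) = if h.length ≤ k then R (x :: h) else 0 := by
    intro k x h; simp [F]
  have hq1 : ∀ h, alg.queryProb h ≤ 1 := fun h => by
    rw [← alg.queryProb_add_stopProb h]; exact le_self_add
  have hFsum : ∀ k, ∑' h, F k h ≠ ⊤ := by
    intro k
    induction k with
    | zero =>
      rw [tsum_list_cons]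
      simp [F, R, reachProb]
    | succ k ih =>
      rw [tsum_list_cons]
      refine ENNReal.add_ne_top.2 ⟨by simp [F, R, reachProb], ne_top_of_le_ne_top ih ?_⟩
      refine ENNReal.tsum_le_tsum fun h => ?_
      simp only [hFcons, F]
      split_ifs with hh
      · rw [hRc]; exact mul_le_of_le_one_right' (hq1 h)
      · simp
  have hφ : ∀ h : Transcript S A, φ h ≤ c + h.length := by
    intro h
    induction h with
    | nil => simp [hnil]
    | cons x h ih =>
      rw [hcons]
      calc d x + φ h ≤ 1 + (c + h.length) := add_le_add (hd x) ih
        _ = _ := by push_cast [List.length_cons]; ring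
  have hFφ : ∀ k, ∑' h, F k h * φ h ≠ ⊤ := by
    intro k
    have : ∑' h, F k h * φ h ≤ (∑' h, F k h) * (c + k) := by
      rw [← ENNReal.tsum_mul_right]
      refine ENNReal.tsum_le_tsum fun h => ?_
      simp only [F]
      split_ifs with hh
      · gcongr
        exact (hφ h).trans (by gcongr)
      · simp
    exact ne_top_of_le_ne_top (ENNReal.mul_ne_top (hFsum k) (by simp [hc])) this
  -- One-step balance: the mass at level `k` splits into querying and stopping mass, and the
  -- querying mass reappears at level `k + 1` with the potential increased by `d`.
  have key : ∀ k, ∑' h, F k h * alg.stopProb h * φ h ≤ c + ∑' h, ∑' x, R (x :: h) * d x := by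
    intro k
    have h1 : ∑' h, F k h * φ h =
        ∑' h, F k h * alg.queryProb h * φ h + ∑' h, F k h * alg.stopProb h * φ h := by
      rw [← ENNReal.tsum_add]
      refine tsum_congr fun h => ?_
      rw [← add_mul, ← mul_add, queryProb_add_stopProb, mul_one]
    have h2 : ∑' h, F k h * φ h ≤ ∑' h, F (k + 1) h * φ h := by
      refine ENNReal.tsum_le_tsum fun h => ?_
      gcongr
      simp only [F]
      split_ifs with h1 h2
      · rfl
      · omega
      · exact zero_le
      · rfl
    have h3 : ∑' h, F (k + 1) h * φ h ≤
        (c + ∑' h, ∑' x, R (x :: h) * d x) + ∑' h, F k h * alg.queryProb h * φ h := by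
      rw [tsum_list_cons, add_assoc, ← ENNReal.tsum_add]
      refine add_le_add (by simp [F, R, reachProb, hnil]) (ENNReal.tsum_le_tsum fun h => ?_)
      simp only [hFcons, F]
      split_ifs with hh
      · rw [← hRc, ← ENNReal.tsum_mul_right, ← ENNReal.tsum_add]
        refine ENNReal.tsum_le_tsum fun x => ?_
        rw [hcons, mul_add]
      · simp
    have h4 : ∑' h, F k h * alg.queryProb h * φ h ≠ ⊤ :=
      ne_top_of_le_ne_top (hFφ k) (h1 ▸ le_self_add)
    have h5 := h2.trans h3
    rw [h1, add_comm] at h5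
    exact (ENNReal.add_le_add_iff_right h4).1 h5
  have hsup : ∀ h, alg.reachProb P h * alg.stopProb h * φ h = ⨆ k, F k h * alg.stopProb h * φ h := by
    intro h
    apply le_antisymm
    · refine le_iSup_of_le h.length ?_
      simp [F, R]
    · refine iSup_le fun k => ?_
      gcongr
      simp only [F]
      split_ifs
      · rfl
      · exact zero_le
  rw [tsum_congr hsup, ENNReal.tsum_eq_iSup_sum]
  refine iSup_le fun s => ?_
  rw [ENNReal.finsetSum_iSup_of_monotone]
  · exact iSup_le fun k => (ENNReal.sum_le_tsum s).trans (key k)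
  · intro h k l hkl
    dsimp only
    gcongr
    simp only [F]
    split_ifs
    · rfl
    · omega
    · exact zero_le
    · rfl

theorem tsum_reachProb_stopProb_le_one (alg : Sampler S A) (P : S → A → PMF S) :
    ∑' h, alg.reachProb P h * alg.stopProb h ≤ 1 := by
  have := alg.tsum_reachProb_stopProb_le P (fun _ => 1) 0 1 (by simp) (by simp) rfl (by simp)
  simpa using this

/-- A run with finitely many samples in expectation stops almost surely. -/
theorem tsum_reachProb_stopProb_eq_one (alg : Sampler S A) (P : S → A → PMF S)
    (hfin : alg.expectedSamples P ≠ ⊤) : ∑' h, alg.reachProb P h * alg.stopProb h = 1 := by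
  -- Each nonempty transcript arises from exactly one query of its tail. Splitting the same total by
  -- stopping or querying gives the claim after cancelling the finite number of samples.
  have h1 : ∑' h, alg.reachProb P h = 1 + alg.expectedSamples P := by
    rw [tsum_list_cons]
    simp only [tsum_reachProb_cons]
    simp [reachProb, expectedSamples, queryProb]
  have h2 : ∑' h, alg.reachProb P h =
      ∑' h, alg.reachProb P h * alg.stopProb h + alg.expectedSamples P := by
    have : alg.expectedSamples P = ∑' h, alg.reachProb P h * alg.queryProb h := rfl
    rw [this, ← ENNReal.tsum_add]
    refine tsum_congr fun h => ?_
    rw [← mul_add, add_comm, queryProb_add_stopProb, mul_one]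
  exact ((ENNReal.add_left_inj hfin).1 (h1.symm.trans h2)).symm

theorem expect_le_one (alg : Sampler S A) (P : S → A → PMF S) {F : MixedPolicy S A → ENNReal}
    (hF : ∀ w, F w ≤ 1) : alg.expect P F ≤ 1 := by
  refine le_trans ?_ (alg.tsum_reachProb_stopProb_le_one P)
  refine ENNReal.tsum_le_tsum fun h => ?_
  gcongr
  exact ENNReal.tsum_le_tsum fun w => mul_le_of_le_one_right' (hF w)

theorem expect_mono (alg : Sampler S A) (P : S → A → PMF S) {F G : MixedPolicy S A → ENNReal}
    (h : ∀ w, F w ≤ G w) : alg.expect P F ≤ alg.expect P G := by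
  unfold expect
  gcongr with a w
  exact h w

theorem expect_add (alg : Sampler S A) (P : S → A → PMF S) (F G : MixedPolicy S A → ENNReal) :
    alg.expect P (fun w => F w + G w) = alg.expect P F + alg.expect P G := by
  simp only [expect, mul_add, ENNReal.tsum_add]

theorem expect_sum {ι : Type*} (alg : Sampler S A) (P : S → A → PMF S) (s : Finset ι)
    (F : ι → MixedPolicy S A → ENNReal) :
    alg.expect P (fun w => ∑ i ∈ s, F i w) = ∑ i ∈ s, alg.expect P (F i) := by
  classical
  induction s using Finset.induction_on with
  | empty => simp [expect]
  | insert a s ha ih =>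
    simp only [Finset.sum_insert ha]
    rw [expect_add, ih]

theorem expect_const_mul (alg : Sampler S A) (P : S → A → PMF S) (c : ENNReal)
    (F : MixedPolicy S A → ENNReal) :
    alg.expect P (fun w => c * F w) = c * alg.expect P F := by
  simp only [expect, ← ENNReal.tsum_mul_left]
  refine tsum_congr fun h => tsum_congr fun w => by ring

theorem expect_one (alg : Sampler S A) (P : S → A → PMF S) :
    alg.expect P (fun _ => 1) = ∑' h, alg.reachProb P h * alg.stopProb h := by
  simp [expect, stopProb]

theorem outputProb_eq_expect (alg : Sampler S A) (P : S → A → PMF S)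
    (G : Set (MixedPolicy S A)) : alg.outputProb P G = alg.expect P (G.indicator 1) := by
  simp only [outputProb, expect]
  refine tsum_congr fun h => ?_
  congr 1
  refine tsum_congr fun w => ?_
  by_cases hw : w ∈ G <;> simp [hw]

/-- Testing inequality: if two kernels are the perturbations of a third one by factors `1 + x` and
`1 - x`, a loss with values in `[0, 1]` that is large under the central kernel is large under the
first one, unless many informative samples are taken. -/
theorem two_mul_expect_le (alg : Sampler S A) (K K₁ K₂ : S → A → PMF S) (x : S → A → S → ℝ)
    (hx : ∀ s a s', |x s a s'| ≤ 1)
    (h₁ : ∀ s a s', K₁ s a s' = K s a s' * ENNReal.ofReal (1 + x s a s'))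
    (h₂ : ∀ s a s', K₂ s a s' = K s a s' * ENNReal.ofReal (1 - x s a s'))
    (F : MixedPolicy S A → ENNReal) (hF : ∀ w, F w ≤ 1) :
    2 * alg.expect K F ≤ alg.expect K₁ F + 1 +
      2 * ∑' q : S × A, alg.pairSamples K q *
        ∑' s', K q.1 q.2 s' * ENNReal.ofReal (x q.1 q.2 s' ^ 2) := by
  let φ : Transcript S A → ENNReal := fun h =>
    (h.map fun t => ENNReal.ofReal (x t.1 t.2.1 t.2.2 ^ 2)).sum
  have hφ := alg.tsum_reachProb_stopProb_le K φ (fun t => ENNReal.ofReal (x t.1 t.2.1 t.2.2 ^ 2)) 0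
    (by simp) (fun t => by
      rw [ENNReal.ofReal_le_one, sq_le_one_iff_abs_le_one]; exact hx _ _ _) rfl (fun t h => by simp [φ])
  have hφ' : ∑' h, ∑' t : S × A × S,
      alg.reachProb K (t :: h) * ENNReal.ofReal (x t.1 t.2.1 t.2.2 ^ 2) =
      ∑' q : S × A, alg.pairSamples K q *
        ∑' s', K q.1 q.2 s' * ENNReal.ofReal (x q.1 q.2 s' ^ 2) := by
    simp only [pairSamples, ← ENNReal.tsum_mul_right]
    rw [ENNReal.tsum_comm (α := S × A)]
    refine tsum_congr fun h => ?_
    rw [tsum_triple]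
    simp only [reachProb, ← ENNReal.tsum_mul_left]
    refine tsum_congr fun q => tsum_congr fun s' => by ring
  rw [zero_add, hφ'] at hφ
  -- `u` and `v` are the likelihood ratios and `y` is the accumulated `∑ x ^ 2`. The opposite signs
  -- make `u * v` the product of the factors `1 - x ^ 2`, which lies between `1 - y` and `1`.
  have hreal : ∀ h : Transcript S A, ∃ u v y : ℝ, 0 ≤ u ∧ 0 ≤ v ∧ 0 ≤ y ∧ u * v ≤ 1 ∧
      1 - y ≤ u * v ∧ alg.reachProb K₁ h = alg.reachProb K h * ENNReal.ofReal u ∧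
      alg.reachProb K₂ h = alg.reachProb K h * ENNReal.ofReal v ∧ φ h = ENNReal.ofReal y := by
    intro h
    induction h with
    | nil => exact ⟨1, 1, 0, by simp [reachProb, φ]⟩
    | cons t h ih =>
      obtain ⟨s, a, s'⟩ := t
      obtain ⟨u, v, y, hu, hv, hy, huv, huvy, e1, e2, e3⟩ := ih
      have hxx := abs_le.1 (hx s a s')
      have h0 : 0 ≤ u * v := mul_nonneg hu hv
      have hs : x s a s' ^ 2 ≤ 1 := by rw [sq_le_one_iff_abs_le_one]; exact hx _ _ _
      have hs0 := sq_nonneg (x s a s')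
      have hprod : u * (1 + x s a s') * (v * (1 - x s a s')) = u * v * (1 - x s a s' ^ 2) := by ring
      refine ⟨u * (1 + x s a s'), v * (1 - x s a s'), x s a s' ^ 2 + y, ?_, ?_, by positivity,
        ?_, ?_, ?_, ?_, ?_⟩
      · exact mul_nonneg hu (by linarith)
      · exact mul_nonneg hv (by linarith)
      · rw [hprod]; nlinarith
      · rw [hprod]; nlinarith
      · rw [reachProb, reachProb, e1, h₁, ENNReal.ofReal_mul hu]; ring
      · rw [reachProb, reachProb, e2, h₂, ENNReal.ofReal_mul hv]; ring
      · rw [ENNReal.ofReal_add hs0 hy, ← e3]; simp [φ]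
  have hpt : ∀ h, 2 * alg.reachProb K h ≤
      alg.reachProb K₁ h + alg.reachProb K₂ h + 2 * (alg.reachProb K h * φ h) := by
    intro h
    obtain ⟨u, v, y, hu, hv, hy, huv, huvy, e1, e2, e3⟩ := hreal h
    rw [e1, e2, e3]
    -- By AM-GM and `u * v ≤ 1`, `u + v ≥ 2 * √(u * v) ≥ 2 * (u * v) ≥ 2 - 2 * y`.
    have : (2 : ENNReal) ≤ ENNReal.ofReal u + ENNReal.ofReal v + 2 * ENNReal.ofReal y := by
      rw [show (2 : ENNReal) = ENNReal.ofReal 2 by simp, ← ENNReal.ofReal_mul (by norm_num),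
        ← ENNReal.ofReal_add hu hv, ← ENNReal.ofReal_add (by positivity) (by positivity)]
      apply ENNReal.ofReal_le_ofReal
      have h0 : 0 ≤ u * v := mul_nonneg hu hv
      nlinarith [sq_nonneg (u - v), sq_nonneg (u + v - 2 * (u * v)), mul_nonneg h0 (sub_nonneg.2 huv)]
    calc 2 * alg.reachProb K h = alg.reachProb K h * 2 := mul_comm _ _
      _ ≤ alg.reachProb K h * (ENNReal.ofReal u + ENNReal.ofReal v + 2 * ENNReal.ofReal y) := by
        gcongr
      _ = _ := by ring
  have hFs : ∀ h, ∑' w, alg h (Sum.inr w) * F w ≤ alg.stopProb h := fun h =>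
    ENNReal.tsum_le_tsum fun w => mul_le_of_le_one_right' (hF w)
  calc 2 * alg.expect K F = ∑' h, (2 * alg.reachProb K h) * ∑' w, alg h (Sum.inr w) * F w := by
        simp only [expect, ← ENNReal.tsum_mul_left]
        refine tsum_congr fun h => tsum_congr fun w => by ring
    _ ≤ ∑' h, (alg.reachProb K₁ h + alg.reachProb K₂ h + 2 * (alg.reachProb K h * φ h)) *
        ∑' w, alg h (Sum.inr w) * F w := by
        gcongr with h
        exact hpt h
    _ ≤ ∑' h, (alg.reachProb K₁ h * (∑' w, alg h (Sum.inr w) * F w) +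
        alg.reachProb K₂ h * (∑' w, alg h (Sum.inr w) * F w) +
        2 * (alg.reachProb K h * alg.stopProb h * φ h)) := by
        refine ENNReal.tsum_le_tsum fun h => ?_
        rw [add_mul, add_mul]
        refine add_le_add le_rfl ?_
        calc 2 * (alg.reachProb K h * φ h) * ∑' w, alg h (Sum.inr w) * F w
            ≤ 2 * (alg.reachProb K h * φ h) * alg.stopProb h := mul_le_mul_right (hFs h) _
          _ = _ := by ring
    _ = alg.expect K₁ F + alg.expect K₂ F +
        2 * ∑' h, alg.reachProb K h * alg.stopProb h * φ h := by
        rw [ENNReal.tsum_add, ENNReal.tsum_add, ENNReal.tsum_mul_left]; rfl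
    _ ≤ _ := by
        gcongr
        -- The second perturbation enters only through this trivial bound, so `K₂` need not belong
        -- to the problem class.
        exact alg.expect_le_one K₂ hF

end Sampler

/-! ### Finite Markov chains: Poisson equations, recurrence, transient times -/

section MarkovChain

set_option linter.unusedSectionVars false

variable {S A : Type} [Fintype S] [DecidableEq S] [Fintype A]

theorem PMF.sum_toReal {α : Type*} [Fintype α] (p : PMF α) : ∑ a, (p a).toReal = 1 := by
  have h := p.tsum_coe
  rw [tsum_fintype] at h
  rw [← ENNReal.toReal_sum fun a _ => p.apply_ne_top a, h, ENNReal.toReal_one]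

theorem PMF.tsum_toReal {α : Type*} (p : PMF α) : ∑' a, (p a).toReal = 1 := by
  rw [← ENNReal.tsum_toReal_eq fun a => p.apply_ne_top a, p.tsum_coe, ENNReal.toReal_one]

theorem chain_nonneg (P : S → A → PMF S) (π : StatPolicy S A) (s s' : S) :
    0 ≤ chain P π s s' := by
  simp only [chain, Matrix.of_apply]
  positivity

theorem chain_mulVec (P : S → A → PMF S) (π : StatPolicy S A) (v : S → ℝ) (s : S) :
    (chain P π).mulVec v s = ∑ a, (π s a).toReal * ∑ s', (P s a s').toReal * v s' := by
  simp only [Matrix.mulVec, dotProduct, chain, Matrix.of_apply, Finset.sum_mul, Finset.mul_sum]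
  rw [Finset.sum_comm]
  simp only [mul_assoc]

theorem chain_sum (P : S → A → PMF S) (π : StatPolicy S A) (s : S) :
    ∑ s', chain P π s s' = 1 := by
  have := chain_mulVec P π (fun _ => 1) s
  simp only [mul_one, PMF.sum_toReal] at this
  simpa [Matrix.mulVec, dotProduct] using this

theorem abs_chain_pow_mulVec_le (P : S → A → PMF S) (π : StatPolicy S A) (v : S → ℝ) (C : ℝ)
    (hv : ∀ s, |v s| ≤ C) (t : ℕ) (s : S) : |((chain P π) ^ t).mulVec v s| ≤ C := by
  induction t generalizing s with
  | zero => simpa using hv s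
  | succ t ih =>
    rw [pow_succ', ← Matrix.mulVec_mulVec]
    calc |(chain P π).mulVec ((chain P π ^ t).mulVec v) s|
        ≤ ∑ s', |chain P π s s' * (chain P π ^ t).mulVec v s'| := Finset.abs_sum_le_sum_abs _ _
      _ ≤ ∑ s', chain P π s s' * C := by
        refine Finset.sum_le_sum fun s' _ => ?_
        rw [abs_mul, abs_of_nonneg (chain_nonneg P π s s')]
        exact mul_le_mul_of_nonneg_left (ih s') (chain_nonneg P π s s')
      _ = C := by rw [← Finset.sum_mul, chain_sum, one_mul]

/-- Since `f = g + h - Q h` and `g` is invariant, the sum telescopes. -/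
theorem sum_pow_mulVec_of_poisson (Q : Matrix S S ℝ) (g h f : S → ℝ) (hg : Q.mulVec g = g)
    (hh : ∀ s, g s + h s = f s + Q.mulVec h s) (T : ℕ) (s : S) :
    ∑ t ∈ Finset.range T, (Q ^ t).mulVec f s = T * g s + h s - (Q ^ T).mulVec h s := by
  have hpow : ∀ t : ℕ, (Q ^ t).mulVec g = g := by
    intro t
    induction t with
    | zero => simp
    | succ t ih => rw [pow_succ, ← Matrix.mulVec_mulVec, hg, ih]
  have hf : f = g + h - Q.mulVec h := by
    funext s
    simp only [Pi.add_apply, Pi.sub_apply]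
    linarith [hh s]
  induction T with
  | zero => simp
  | succ T ih =>
    rw [Finset.sum_range_succ, ih, hf, Matrix.mulVec_sub, Matrix.mulVec_add, hpow,
      Matrix.mulVec_mulVec, ← pow_succ]
    simp only [Pi.add_apply, Pi.sub_apply]
    push_cast
    ring

theorem tendsto_div_of_bounded_remainder (u e : ℕ → ℝ) (a C : ℝ)
    (hu : ∀ T, u T = T * a + e T) (he : ∀ T, |e T| ≤ C) :
    Tendsto (fun T : ℕ => u T / T) atTop (𝓝 a) := by
  have h1 : Tendsto (fun T : ℕ => e T / T) atTop (𝓝 0) := by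
    refine squeeze_zero_norm (a := fun T : ℕ => C / T) (fun T => ?_)
      (tendsto_const_div_atTop_nhds_zero_nat C)
    rw [Real.norm_eq_abs, abs_div, Nat.abs_cast]
    exact div_le_div_of_nonneg_right (he T) (Nat.cast_nonneg T)
  have h2 : Tendsto (fun T : ℕ => a + e T / T) atTop (𝓝 a) := by simpa using h1.const_add a
  refine h2.congr' ?_
  filter_upwards [eventually_gt_atTop 0] with T hT
  have : (T : ℝ) ≠ 0 := by positivity
  rw [hu]
  field_simp

/-- A solution of the Poisson equation with invariant gain determines the gain. -/
theorem gain_eq_of_poisson (P : S → A → PMF S) (f : S → A → ℝ) (π : StatPolicy S A)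
    (g h : S → ℝ) (hg : (chain P π).mulVec g = g)
    (hh : ∀ s, g s + h s = meanReward f π s + (chain P π).mulVec h s) : gain P f π = g := by
  funext s
  refine Tendsto.limUnder_eq (tendsto_div_of_bounded_remainder _
    (fun T => h s - (chain P π ^ T).mulVec h s) _ (2 * ∑ s, |h s|) (fun T => ?_) fun T => ?_)
  · simp only [rewardAt]
    rw [sum_pow_mulVec_of_poisson _ g h _ hg hh]
    ring
  · have hb : ∀ s, |h s| ≤ ∑ s, |h s| := fun s =>
      Finset.single_le_sum (f := fun s => |h s|) (fun _ _ => abs_nonneg _) (Finset.mem_univ s)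
    have h1 := abs_chain_pow_mulVec_le P π h _ hb T s
    have h2 := abs_sub (h s) ((chain P π ^ T).mulVec h s)
    linarith [hb s]

/-- A solution `h` of the Poisson equation that is itself in the range of `1 - Q` is the bias. -/
theorem bias_eq_of_poisson (P : S → A → PMF S) (f : S → A → ℝ) (π : StatPolicy S A)
    (g h k : S → ℝ) (hg : (chain P π).mulVec g = g)
    (hh : ∀ s, g s + h s = meanReward f π s + (chain P π).mulVec h s)
    (hk : ∀ s, k s = h s + (chain P π).mulVec k s) : bias P f π = h := by
  have hpow : ∀ t : ℕ, (chain P π ^ t).mulVec g = g := by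
    intro t
    induction t with
    | zero => simp
    | succ t ih => rw [pow_succ, ← Matrix.mulVec_mulVec, hg, ih]
  have hc : ∀ T s, centeredSum P f π T s = h s - (chain P π ^ T).mulVec h s := by
    intro T s
    simp only [centeredSum]
    rw [gain_eq_of_poisson P f π g h hg hh, Finset.sum_sub_distrib]
    simp only [rewardAt, hpow]
    rw [sum_pow_mulVec_of_poisson _ g h _ hg hh]
    simp
    ring
  funext s
  refine Tendsto.limUnder_eq (tendsto_div_of_bounded_remainder _
    (fun T => (chain P π ^ T).mulVec k s - k s) _ (2 * ∑ s, |k s|) (fun T => ?_) fun T => ?_)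
  · simp only [hc, Finset.sum_sub_distrib]
    -- The equation for `k` is a Poisson equation with gain `0` and reward `h`. So the sums of `Q ^
    -- T h` are bounded and disappear in the Cesàro mean; this singles out the bias among the
    -- solutions of the Poisson equation.
    have := sum_pow_mulVec_of_poisson (chain P π) 0 k h (Matrix.mulVec_zero _)
      (fun s => by simpa using hk s) T s
    rw [this]
    simp
    ring
  · have hb : ∀ s, |k s| ≤ ∑ s, |k s| := fun s =>
      Finset.single_le_sum (f := fun s => |k s|) (fun _ _ => abs_nonneg _) (Finset.mem_univ s)
    have h1 := abs_chain_pow_mulVec_le P π k _ hb T s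
    have h2 := abs_sub ((chain P π ^ T).mulVec k s) (k s)
    linarith [hb s]

theorem Reaches.mem_of_closed {Q : Matrix S S ℝ} {C : Set S}
    (hC : ∀ s ∈ C, ∀ s' ∉ C, Q s s' = 0) {s s' : S} (h : Reaches Q s s') (hs : s ∈ C) :
    s' ∈ C := by
  by_contra hs'
  obtain ⟨n, hn⟩ := h
  have : ∀ n, ∀ s' ∉ C, (Q ^ n) s s' = 0 := by
    intro n
    induction n with
    | zero =>
      intro s' hs'
      rw [pow_zero, Matrix.one_apply_ne]
      rintro rfl
      exact hs' hs
    | succ n ih =>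
      intro s' hs'
      rw [pow_succ, Matrix.mul_apply]
      refine Finset.sum_eq_zero fun t _ => ?_
      by_cases ht : t ∈ C
      · rw [hC t ht s' hs', mul_zero]
      · rw [ih t ht, zero_mul]
  rw [this n s' hs'] at hn
  exact lt_irrefl _ hn

theorem isRecurrent_of_closed {Q : Matrix S S ℝ} {C : Set S}
    (hC : ∀ s ∈ C, ∀ s' ∉ C, Q s s' = 0) (hr : ∀ s ∈ C, ∀ s' ∈ C, Reaches Q s s') {s : S}
    (hs : s ∈ C) : IsRecurrent Q s :=
  fun s' h => hr s' (h.mem_of_closed hC hs) s hs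

theorem surviveProb_of_isRecurrent {Q : Matrix S S ℝ} {s : S} (h : IsRecurrent Q s) (t : ℕ) :
    surviveProb Q t s = 0 := by
  cases t <;> simp [surviveProb, h]

theorem expectedTransientTime_of_isRecurrent {Q : Matrix S S ℝ} {s : S} (h : IsRecurrent Q s) :
    expectedTransientTime Q s = 0 := by
  simp [expectedTransientTime, surviveProb_of_isRecurrent h]

/-- A state that is left with probability `p` in every step, towards recurrent states only, has
expected transient time at most `1 / p`. -/
theorem expectedTransientTime_le {Q : Matrix S S ℝ} {s : S} {p : ℝ}
    (hp : 0 < p) (hp1 : p ≤ 1) (hs : Q s s = 1 - p)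
    (hr : ∀ s', s' ≠ s → Q s s' ≠ 0 → IsRecurrent Q s') :
    expectedTransientTime Q s ≤ ENNReal.ofReal (1 / p) := by
  have hb : ∀ t, surviveProb Q t s ≤ (1 - p) ^ t := by
    intro t
    induction t with
    | zero => simp only [surviveProb]; split_ifs <;> norm_num
    | succ t ih =>
      simp only [surviveProb]
      split_ifs
      · exact pow_nonneg (by linarith) _
      · rw [Finset.sum_eq_single s, hs, pow_succ']
        · exact mul_le_mul_of_nonneg_left ih (by linarith)
        · intro s' _ hne
          by_cases h0 : Q s s' = 0
          · rw [h0, zero_mul]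
          · rw [surviveProb_of_isRecurrent (hr s' hne h0), mul_zero]
        · simp
  calc expectedTransientTime Q s ≤ ∑' t : ℕ, ENNReal.ofReal (1 - p) ^ t := by
        refine ENNReal.tsum_le_tsum fun t => ?_
        rw [← ENNReal.ofReal_pow (by linarith)]
        exact ENNReal.ofReal_le_ofReal (hb t)
    _ = (1 - ENNReal.ofReal (1 - p))⁻¹ := ENNReal.tsum_geometric _
    _ = ENNReal.ofReal (1 / p) := by
        rw [← ENNReal.ofReal_one, ← ENNReal.ofReal_sub _ (by linarith), one_div,
          ENNReal.ofReal_inv_of_pos hp]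
        congr 2
        ring
    _ ≤ _ := le_rfl

end MarkovChain

/-! ### The family of hard instances: layout and kernel -/

/-- Perturbations of the exit probabilities. -/
abbrev Shift : Type := Set.Icc (-(1 / 8) : ℝ) (1 / 8)

instance : Zero Shift := ⟨⟨0, by norm_num⟩⟩

instance : Neg Shift := ⟨fun x => ⟨-x, by linarith [x.2.2], by linarith [x.2.1]⟩⟩

theorem Shift.coe_zero : ((0 : Shift) : ℝ) = 0 := rfl

theorem Shift.coe_neg (x : Shift) : ((-x : Shift) : ℝ) = -x := rfl

/-- The shape of a family of CAMDPs whose state space consists of `n` components with a decision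
state and three outcome states each, and of `d` isolated absorbing states. A decision state is
left with probability `p`, an outcome state with probability `β`, and `safe` is the action with a
known outcome distribution. -/
structure Layout (S A : Type) (n d : ℕ) where
  e : S ≃ (Fin n × Option (Fin 3)) ⊕ Fin d
  p : unitInterval
  β : unitInterval
  safe : A

namespace Layout

set_option linter.unusedSectionVars false

section Kernel

variable {S A : Type} [Fintype S] [DecidableEq A] {n d : ℕ} (L : Layout S A n d)

/-- The state of component `i` with role `r`: the decision state is `none`. -/
def st (i : Fin n) (r : Option (Fin 3)) : S := L.e.symm (Sum.inl (i, r))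

/-- An isolated absorbing state. -/
def dummy (k : Fin d) : S := L.e.symm (Sum.inr k)

theorem state_cases {motive : S → Prop} (h1 : ∀ i r, motive (L.st i r))
    (h2 : ∀ k, motive (L.dummy k)) (s : S) : motive s := by
  rcases h : L.e s with ⟨i, r⟩ | k
  · have := h1 i r
    rwa [st, ← h, Equiv.symm_apply_apply] at this
  · have := h2 k
    rwa [dummy, ← h, Equiv.symm_apply_apply] at this

@[simp] theorem e_st (i : Fin n) (r : Option (Fin 3)) : L.e (L.st i r) = Sum.inl (i, r) := by
  simp [st]

@[simp] theorem e_dummy (k : Fin d) : L.e (L.dummy k) = Sum.inr k := by simp [dummy]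

theorem sum_states (f : S → ℝ) :
    ∑ s, f s = ∑ i, ∑ r, f (L.st i r) + ∑ k, f (L.dummy k) := by
  rw [← L.e.symm.sum_comp, Fintype.sum_sum_type, Fintype.sum_prod_type]
  rfl

/-- The unperturbed outcome distribution of an action. -/
def baseDist (a : A) : Fin 3 → ℝ :=
  if a = L.safe then ![1 / 4, 1 / 4, 1 / 2] else ![3 / 8, 3 / 8, 1 / 4]

/-- The perturbed outcome distribution of an action. -/
def exitDist (x : Shift) (a : A) : Fin 3 → ℝ := L.baseDist a + (x : ℝ) • ![1, -1, 0]

theorem exitDist_pos (x : Shift) (a : A) (z : Fin 3) :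
    0 < L.exitDist x a z := by
  have h1 := x.2.1
  have h2 := x.2.2
  fin_cases z <;> by_cases h : a = L.safe <;> simp [exitDist, baseDist, h] <;> linarith

theorem sum_exitDist (x : Shift) (a : A) : ∑ z, L.exitDist x a z = 1 := by
  by_cases h : a = L.safe <;> simp [exitDist, baseDist, h, Fin.sum_univ_three] <;> ring

/-- Transition probabilities between the states of a component. -/
def jump (x : Shift) (a : A) : Option (Fin 3) → Option (Fin 3) → ℝ
  | none, none => 1 - L.p
  | none, some z => L.p * L.exitDist x a z
  | some _, none => L.β
  | some z, some z' => if z' = z then 1 - L.β else 0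

theorem jump_nonneg (x : Shift) (a : A) (r r' : Option (Fin 3)) : 0 ≤ L.jump x a r r' := by
  have h1 := L.p.2
  have h2 := L.β.2
  rcases r with _ | z <;> rcases r' with _ | z' <;> simp only [jump]
  · linarith [h1.2]
  · exact mul_nonneg h1.1 (L.exitDist_pos x a z').le
  · exact h2.1
  · split_ifs
    · linarith [h2.2]
    · rfl

theorem sum_jump (x : Shift) (a : A) (r : Option (Fin 3)) : ∑ r', L.jump x a r r' = 1 := by
  rcases r with _ | z <;> simp [Fintype.sum_option, jump, ← Finset.mul_sum, sum_exitDist]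

/-- Transition probabilities of the CAMDPs of the family. -/
def trans (x : Fin n → A → Shift) (s : S) (a : A) (s' : S) : ℝ :=
  match L.e s, L.e s' with
  | Sum.inl (i, r), Sum.inl (j, r') => if j = i then L.jump (x i a) a r r' else 0
  | Sum.inr k, Sum.inr l => if l = k then 1 else 0
  | _, _ => 0

theorem trans_nonneg (x : Fin n → A → Shift) (s : S) (a : A) (s' : S) :
    0 ≤ L.trans x s a s' := by
  unfold trans
  split
  · split_ifs
    · exact L.jump_nonneg _ _ _ _
    · rfl
  · split_ifs <;> norm_num
  · rfl

theorem sum_trans_st (x : Fin n → A → Shift) (i : Fin n) (r : Option (Fin 3)) (a : A)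
    (v : S → ℝ) :
    ∑ s', L.trans x (L.st i r) a s' * v s' = ∑ r', L.jump (x i a) a r r' * v (L.st i r') := by
  rw [L.sum_states]
  simp only [trans, e_st, e_dummy, ite_mul, zero_mul, Finset.sum_const_zero, add_zero]
  rw [Finset.sum_eq_single i]
  · simp
  · intro j _ hj
    simp [hj]
  · simp

theorem sum_trans_dummy (x : Fin n → A → Shift) (k : Fin d) (a : A) (v : S → ℝ) :
    ∑ s', L.trans x (L.dummy k) a s' * v s' = v (L.dummy k) := by
  rw [L.sum_states]
  simp [trans]

theorem sum_trans (x : Fin n → A → Shift) (s : S) (a : A) : ∑ s', L.trans x s a s' = 1 := by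
  induction s using L.state_cases with
  | h1 i r =>
    have := L.sum_trans_st x i r a fun _ => 1
    simpa only [mul_one, sum_jump] using this
  | h2 k => simpa only [mul_one] using L.sum_trans_dummy x k a fun _ => 1

/-- The transition kernel of the CAMDPs of the family. -/
def kernel (x : Fin n → A → Shift) (s : S) (a : A) : PMF S :=
  PMF.ofFintype (fun s' => ENNReal.ofReal (L.trans x s a s')) (by
    rw [← ENNReal.ofReal_sum_of_nonneg fun s' _ => L.trans_nonneg x s a s', sum_trans,
      ENNReal.ofReal_one])

theorem kernel_apply (x : Fin n → A → Shift) (s : S) (a : A) (s' : S) :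
    L.kernel x s a s' = ENNReal.ofReal (L.trans x s a s') := rfl

theorem toReal_kernel (x : Fin n → A → Shift) (s : S) (a : A) (s' : S) :
    (L.kernel x s a s').toReal = L.trans x s a s' := by
  rw [kernel_apply, ENNReal.toReal_ofReal (L.trans_nonneg x s a s')]

end Kernel

/-! ### Gains, biases and transient times in the family -/

section Chain

variable {S A : Type} [Fintype S] [DecidableEq S] [Fintype A] [DecidableEq A] {n d : ℕ}
  (L : Layout S A n d)

/-- The outcome distribution of a policy in a component. -/
def mix (x : Fin n → A → Shift) (π : StatPolicy S A) (i : Fin n) (z : Fin 3) : ℝ :=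
  ∑ a, (π (L.st i none) a).toReal * L.exitDist (x i a) a z

/-- The mean perturbation of a policy in a component. -/
def meanShift (x : Fin n → A → Shift) (π : StatPolicy S A) (i : Fin n) : ℝ :=
  ∑ a, (π (L.st i none) a).toReal * x i a

/-- The value of the unperturbed outcome distribution of a policy in a component. -/
def baseValue (v : Fin 3 → ℝ) (π : StatPolicy S A) (i : Fin n) : ℝ :=
  ∑ a, (π (L.st i none) a).toReal * ∑ z, L.baseDist a z * v z

theorem mix_nonneg (x : Fin n → A → Shift) (π : StatPolicy S A) (i : Fin n) (z : Fin 3) :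
    0 ≤ L.mix x π i z :=
  Finset.sum_nonneg fun a _ => mul_nonneg ENNReal.toReal_nonneg (L.exitDist_pos (x i a) a z).le

theorem sum_mix (x : Fin n → A → Shift) (π : StatPolicy S A) (i : Fin n) :
    ∑ z, L.mix x π i z = 1 := by
  simp only [mix]
  rw [Finset.sum_comm]
  simp only [← Finset.mul_sum, sum_exitDist, mul_one, PMF.sum_toReal]

/-- Perturbations only exchange mass between the outcomes `0` and `1`, so they are seen through `v 0
- v 1` alone. -/
theorem sum_mix_mul (x : Fin n → A → Shift) (π : StatPolicy S A) (i : Fin n) (v : Fin 3 → ℝ) :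
    ∑ z, L.mix x π i z * v z = L.baseValue v π i + L.meanShift x π i * (v 0 - v 1) := by
  simp only [mix, baseValue, meanShift, Fin.sum_univ_three, Finset.sum_mul, ← Finset.sum_add_distrib]
  refine Finset.sum_congr rfl fun a _ => ?_
  simp [exitDist]
  ring

theorem chain_mulVec_decision (x : Fin n → A → Shift) (π : StatPolicy S A) (v : S → ℝ)
    (i : Fin n) : (chain (L.kernel x) π).mulVec v (L.st i none) =
      (1 - L.p) * v (L.st i none) + L.p * ∑ z, L.mix x π i z * v (L.st i (some z)) := by
  have h := PMF.sum_toReal (π (L.st i none))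
  simp only [chain_mulVec, toReal_kernel, sum_trans_st, Fintype.sum_option, jump, mix, mul_add,
    Finset.sum_add_distrib]
  rw [← Finset.sum_mul, h, one_mul]
  congr 1
  simp only [Finset.mul_sum, Finset.sum_mul]
  rw [Finset.sum_comm]
  exact Finset.sum_congr rfl fun z _ => Finset.sum_congr rfl fun a _ => by ring

theorem chain_mulVec_outcome (x : Fin n → A → Shift) (π : StatPolicy S A) (v : S → ℝ)
    (i : Fin n) (z : Fin 3) : (chain (L.kernel x) π).mulVec v (L.st i (some z)) =
      L.β * v (L.st i none) + (1 - L.β) * v (L.st i (some z)) := by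
  simp only [chain_mulVec, toReal_kernel, sum_trans_st, Fintype.sum_option, jump, ite_mul,
    zero_mul, Finset.sum_ite_eq', Finset.mem_univ, if_true]
  rw [← Finset.sum_mul, PMF.sum_toReal, one_mul]

theorem chain_mulVec_dummy (x : Fin n → A → Shift) (π : StatPolicy S A) (v : S → ℝ)
    (k : Fin d) : (chain (L.kernel x) π).mulVec v (L.dummy k) = v (L.dummy k) := by
  simp only [chain_mulVec, toReal_kernel, sum_trans_dummy]
  rw [← Finset.sum_mul, PMF.sum_toReal, one_mul]

/-- The reward function with value `v z` in the outcome states; the decision states are worth as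
much as the unperturbed outcome distribution. -/
def reward (v : Fin 3 → ℝ) (s : S) (a : A) : ℝ :=
  match L.e s with
  | Sum.inl (_, none) => ∑ z, L.baseDist a z * v z
  | Sum.inl (_, some z) => v z
  | Sum.inr _ => 0

theorem meanReward_decision (v : Fin 3 → ℝ) (π : StatPolicy S A) (i : Fin n) :
    meanReward (L.reward v) π (L.st i none) = L.baseValue v π i := by
  simp [meanReward, reward, baseValue]

theorem meanReward_outcome (v : Fin 3 → ℝ) (π : StatPolicy S A) (i : Fin n) (z : Fin 3) :
    meanReward (L.reward v) π (L.st i (some z)) = v z := by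
  simp [meanReward, reward, ← Finset.sum_mul, PMF.sum_toReal]

theorem meanReward_dummy (v : Fin 3 → ℝ) (π : StatPolicy S A) (k : Fin d) :
    meanReward (L.reward v) π (L.dummy k) = 0 := by
  simp [meanReward, reward]

/-- The function on states with the given values on the components and `0` elsewhere. -/
def extend (F : Fin n → Option (Fin 3) → ℝ) (s : S) : ℝ :=
  match L.e s with
  | Sum.inl (i, r) => F i r
  | Sum.inr _ => 0

@[simp] theorem extend_st (F : Fin n → Option (Fin 3) → ℝ) (i : Fin n) (r : Option (Fin 3)) :
    L.extend F (L.st i r) = F i r := by simp [extend]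

@[simp] theorem extend_dummy (F : Fin n → Option (Fin 3) → ℝ) (k : Fin d) :
    L.extend F (L.dummy k) = 0 := by simp [extend]

/-- A decision state is paid the unperturbed outcome value, so each step there deviates from the
gain only by the perturbation term; about `1 / p` such steps occur. The certificate that normalises
the bias is the bias divided by `p`. -/
theorem gain_bias_of_absorbing (hp : 0 < (L.p : ℝ)) (hβ : (L.β : ℝ) = 0)
    (x : Fin n → A → Shift) (v : Fin 3 → ℝ) (π : StatPolicy S A) :
    gain (L.kernel x) (L.reward v) π = L.extend (fun i r => r.elim
      (L.baseValue v π i + L.meanShift x π i * (v 0 - v 1)) v) ∧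
    bias (L.kernel x) (L.reward v) π = L.extend (fun i r => r.elim
      (-(L.meanShift x π i * (v 0 - v 1)) / L.p) 0) := by
  have hg : (chain (L.kernel x) π).mulVec (L.extend (fun i r => r.elim
      (L.baseValue v π i + L.meanShift x π i * (v 0 - v 1)) v)) = L.extend (fun i r => r.elim
      (L.baseValue v π i + L.meanShift x π i * (v 0 - v 1)) v) := by
    funext s
    induction s using L.state_cases with
    | h1 i r =>
      rcases r with _ | z
      · simp only [chain_mulVec_decision, extend_st, Option.elim, sum_mix_mul]
        ring
      · simp [chain_mulVec_outcome, hβ]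
    | h2 k => simp [chain_mulVec_dummy]
  have hh : ∀ s, L.extend (fun i r => r.elim
      (L.baseValue v π i + L.meanShift x π i * (v 0 - v 1)) v) s +
      L.extend (fun i r => r.elim (-(L.meanShift x π i * (v 0 - v 1)) / L.p) 0) s =
      meanReward (L.reward v) π s + (chain (L.kernel x) π).mulVec (L.extend (fun i r => r.elim
        (-(L.meanShift x π i * (v 0 - v 1)) / L.p) 0)) s := by
    intro s
    induction s using L.state_cases with
    | h1 i r =>
      rcases r with _ | z
      · simp only [chain_mulVec_decision, extend_st, Option.elim, meanReward_decision]
        simp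
        field_simp
        ring
      · simp [chain_mulVec_outcome, hβ, meanReward_outcome]
    | h2 k => simp [chain_mulVec_dummy, meanReward_dummy]
  refine ⟨gain_eq_of_poisson _ _ _ _ _ hg hh, bias_eq_of_poisson _ _ _ _ _
    (L.extend (fun i r => r.elim (-(L.meanShift x π i * (v 0 - v 1)) / L.p / L.p) 0)) hg hh ?_⟩
  intro s
  induction s using L.state_cases with
  | h1 i r =>
    rcases r with _ | z
    · simp only [chain_mulVec_decision, extend_st, Option.elim]
      simp
      field_simp
      ring
    · simp [chain_mulVec_outcome, hβ]
  | h2 k => simp [chain_mulVec_dummy]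

/-- Half of the time is spent in the decision state, whose reward ignores the perturbation; hence
the factor `1 / 2`. The additive constant in the bias makes its stationary mean zero. -/
theorem gain_bias_of_returning (hp : 0 < (L.p : ℝ)) (hβ : (L.β : ℝ) = L.p)
    (x : Fin n → A → Shift) (v : Fin 3 → ℝ) (π : StatPolicy S A) :
    gain (L.kernel x) (L.reward v) π = L.extend (fun i _ =>
      L.baseValue v π i + L.meanShift x π i * (v 0 - v 1) / 2) ∧
    bias (L.kernel x) (L.reward v) π = L.extend (fun i r => r.elim
      (-(L.meanShift x π i * (v 0 - v 1)) / (4 * L.p))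
      (fun z => (v z - (L.baseValue v π i + L.meanShift x π i * (v 0 - v 1) / 2)) / L.p +
        -(L.meanShift x π i * (v 0 - v 1)) / (4 * L.p))) := by
  set g : S → ℝ := L.extend (fun i _ =>
      L.baseValue v π i + L.meanShift x π i * (v 0 - v 1) / 2) with hgdef
  set F : Fin n → Option (Fin 3) → ℝ := fun i r => r.elim
      (-(L.meanShift x π i * (v 0 - v 1)) / (4 * L.p))
      (fun z => (v z - (L.baseValue v π i + L.meanShift x π i * (v 0 - v 1) / 2)) / L.p +
        -(L.meanShift x π i * (v 0 - v 1)) / (4 * L.p)) with hF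
  have hmix : ∀ i, ∑ z, L.mix x π i z * F i (some z) =
      L.meanShift x π i * (v 0 - v 1) / (4 * L.p) := by
    intro i
    have h1 := L.sum_mix x π i
    have h2 := L.sum_mix_mul x π i v
    simp only [Fin.sum_univ_three] at h1 h2
    simp only [hF, Option.elim, Fin.sum_univ_three]
    have h3 : L.mix x π i 2 = 1 - L.mix x π i 0 - L.mix x π i 1 := by linarith
    rw [h3] at h2 ⊢
    field_simp
    linear_combination 8 * h2
  have hg : (chain (L.kernel x) π).mulVec g = g := by
    funext s
    induction s using L.state_cases with
    | h1 i r =>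
      rcases r with _ | z
      · simp only [chain_mulVec_decision, hgdef, extend_st, ← Finset.sum_mul, sum_mix]
        ring
      · simp only [chain_mulVec_outcome, hgdef, extend_st]
        ring
    | h2 k => simp [chain_mulVec_dummy]
  have hh : ∀ s, g s + L.extend F s =
      meanReward (L.reward v) π s + (chain (L.kernel x) π).mulVec (L.extend F) s := by
    intro s
    induction s using L.state_cases with
    | h1 i r =>
      rcases r with _ | z
      · simp only [chain_mulVec_decision, hgdef, extend_st, meanReward_decision, hmix]
        simp only [hF, Option.elim]
        field_simp
        ring
      · simp only [chain_mulVec_outcome, hgdef, extend_st, meanReward_outcome, hβ]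
        simp only [hF, Option.elim]
        field_simp
        ring
    | h2 k => simp [hgdef, chain_mulVec_dummy, meanReward_dummy]
  refine ⟨gain_eq_of_poisson _ _ _ _ _ hg hh, bias_eq_of_poisson _ _ _ _ _
    (L.extend (fun i r => r.elim 0 (fun z => F i (some z) / L.p))) hg hh ?_⟩
  intro s
  induction s using L.state_cases with
  | h1 i r =>
    rcases r with _ | z
    · simp only [chain_mulVec_decision, extend_st, Option.elim, ← mul_div_assoc,
        ← Finset.sum_div, hmix]
      simp only [hF, Option.elim]
      field_simp
      ring
    · simp only [chain_mulVec_outcome, extend_st, Option.elim, hβ]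
      field_simp
      ring
  | h2 k => simp [chain_mulVec_dummy]

theorem isRecurrent_dummy (x : Fin n → A → Shift) (π : StatPolicy S A) (k : Fin d) :
    IsRecurrent (chain (L.kernel x) π) (L.dummy k) := by
  refine isRecurrent_of_closed (C := {L.dummy k}) ?_ ?_ rfl
  · rintro s rfl s' hs'
    simp only [Set.mem_singleton_iff] at hs'
    have := L.chain_mulVec_dummy x π (Pi.single s' 1) k
    simpa [Matrix.mulVec_single_one, Matrix.col_apply, Ne.symm hs'] using this
  · rintro s rfl s' rfl
    exact ⟨0, by simp⟩

theorem isRecurrent_outcome_of_absorbing (hβ : (L.β : ℝ) = 0) (x : Fin n → A → Shift)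
    (π : StatPolicy S A) (i : Fin n) (z : Fin 3) :
    IsRecurrent (chain (L.kernel x) π) (L.st i (some z)) := by
  refine isRecurrent_of_closed (C := {L.st i (some z)}) ?_ ?_ rfl
  · rintro s rfl s' hs'
    simp only [Set.mem_singleton_iff] at hs'
    have := L.chain_mulVec_outcome x π (Pi.single s' 1) i z
    simpa [Matrix.mulVec_single_one, Matrix.col_apply, Ne.symm hs', hβ] using this
  · rintro s rfl s' rfl
    exact ⟨0, by simp⟩

theorem isRecurrent_of_returning (hp : 0 < (L.p : ℝ)) (hp1 : (L.p : ℝ) < 1)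
    (hβ : (L.β : ℝ) = L.p) (x : Fin n → A → Shift) (π : StatPolicy S A) (s : S) :
    IsRecurrent (chain (L.kernel x) π) s := by
  induction s using L.state_cases with
  | h2 k => exact L.isRecurrent_dummy x π k
  | h1 i r =>
    -- Matrix entries are read off as the action on indicator functions, for which explicit formulas
    -- are available.
    have hentry : ∀ s s', chain (L.kernel x) π s s' =
        (chain (L.kernel x) π).mulVec (Pi.single s' 1) s := by
      intro s s'
      simp [Matrix.col_apply]
    refine isRecurrent_of_closed (C := Set.range (L.st i)) ?_ ?_ ⟨r, rfl⟩
    · rintro _ ⟨r, rfl⟩ s' hs'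
      have h : ∀ r', (Pi.single s' 1 : S → ℝ) (L.st i r') = 0 := fun r' =>
        Pi.single_eq_of_ne (fun h => hs' ⟨r', h⟩) _
      rw [hentry]
      rcases r with _ | z
      · simp [chain_mulVec_decision, h]
      · simp [chain_mulVec_outcome, h]
    · have hst : ∀ r r', L.st i r = L.st i r' ↔ r = r' := by
        intro r r'
        simp [st]
      have hin : ∀ r, 0 < chain (L.kernel x) π (L.st i r) (L.st i none) := by
        intro r
        rw [hentry]
        rcases r with _ | z
        · simp [chain_mulVec_decision, hst, hp1]
        · simp [chain_mulVec_outcome, hst, hβ, hp]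
      have hout : ∀ r, 0 < chain (L.kernel x) π (L.st i none) (L.st i r) := by
        intro r
        rcases r with _ | z
        · exact hin none
        · rw [hentry, chain_mulVec_decision]
          simp only [Pi.single_apply, hst, Option.some.injEq, mul_ite, mul_one, mul_zero,
            Finset.sum_ite_eq', Finset.mem_univ, if_true, reduceCtorEq, if_false,
            zero_add]
          refine mul_pos hp ?_
          obtain ⟨a, ha⟩ := (π (L.st i none)).support_nonempty
          exact Finset.sum_pos' (fun a _ => mul_nonneg ENNReal.toReal_nonneg
            (L.exitDist_pos _ a z).le) ⟨a, Finset.mem_univ _, mul_pos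
            (ENNReal.toReal_pos ha (PMF.apply_ne_top _ _)) (L.exitDist_pos _ a z)⟩
      rintro _ ⟨r, rfl⟩ _ ⟨r', rfl⟩
      -- Any two states of a component are joined in exactly two steps through the decision state,
      -- which has a self-loop because `p < 1`.
      refine ⟨2, ?_⟩
      rw [pow_two, Matrix.mul_apply]
      exact Finset.sum_pos' (fun t _ => mul_nonneg (chain_nonneg _ _ _ _) (chain_nonneg _ _ _ _))
        ⟨L.st i none, Finset.mem_univ _, mul_pos (hin r) (hout r')⟩

theorem expectedTransientTime_le_of_absorbing (hp : 0 < (L.p : ℝ)) (hβ : (L.β : ℝ) = 0)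
    (x : Fin n → A → Shift) (π : StatPolicy S A) (s : S) :
    expectedTransientTime (chain (L.kernel x) π) s ≤ ENNReal.ofReal (1 / L.p) := by
  have hentry : ∀ s s', chain (L.kernel x) π s s' =
      (chain (L.kernel x) π).mulVec (Pi.single s' 1) s := by
    intro s s'
    simp [Matrix.col_apply]
  induction s using L.state_cases with
  | h2 k =>
    rw [expectedTransientTime_of_isRecurrent (L.isRecurrent_dummy x π k)]
    exact zero_le
  | h1 i r =>
    rcases r with _ | z
    · have hst : ∀ r r', L.st i r = L.st i r' ↔ r = r' := by
        intro r r'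
        simp [st]
      refine expectedTransientTime_le hp L.p.2.2 ?_ ?_
      · rw [hentry, chain_mulVec_decision]
        simp [hst]
      · intro s' hs' hQ
        induction s' using L.state_cases with
        | h2 k => exact L.isRecurrent_dummy x π k
        | h1 j r' =>
          rcases r' with _ | z
          · exfalso
            apply hQ
            rw [hentry, chain_mulVec_decision, Pi.single_eq_of_ne hs'.symm]
            simp [st]
          · exact L.isRecurrent_outcome_of_absorbing hβ x π j z
    · rw [expectedTransientTime_of_isRecurrent (L.isRecurrent_outcome_of_absorbing hβ x π i z)]
      exact zero_le

/-- The factor that translates perturbations of exit probabilities into gains. -/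
def IsFactor (γ : ℝ) : Prop := ((L.β : ℝ) = 0 ∧ γ = 1) ∨ ((L.β : ℝ) = L.p ∧ γ = 1 / 2)

theorem gain_decision {γ : ℝ} (hγ : L.IsFactor γ) (hp : 0 < (L.p : ℝ)) (x : Fin n → A → Shift)
    (v : Fin 3 → ℝ) (π : StatPolicy S A) (i : Fin n) :
    gain (L.kernel x) (L.reward v) π (L.st i none) =
      L.baseValue v π i + γ * L.meanShift x π i * (v 0 - v 1) := by
  rcases hγ with ⟨hβ, rfl⟩ | ⟨hβ, rfl⟩
  · rw [(L.gain_bias_of_absorbing hp hβ x v π).1]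
    simp
  · rw [(L.gain_bias_of_returning hp hβ x v π).1]
    simp
    ring

/-- The bias lies between `-(δ / p)` and `0`. The factor `δ` is what permits `H` to be much smaller
than `B`. -/
theorem biasSpanBounded_of_absorbing (hp : 0 < (L.p : ℝ)) (hβ : (L.β : ℝ) = 0)
    (x : Fin n → A → Shift) (v : Fin 3 → ℝ) (hv : v 0 - v 1 ∈ Set.Icc (0 : ℝ) 1) {δ H : ℝ}
    (hδ : 0 ≤ δ) (hx : ∀ π i, L.meanShift x π i ∈ Set.Icc 0 δ) (hH : δ / L.p ≤ H) :
    BiasSpanBounded (L.kernel x) (L.reward v) H := by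
  intro π s s'
  rw [(L.gain_bias_of_absorbing hp hβ x v π).2]
  have hb : ∀ s, L.extend (fun i r => r.elim (-(L.meanShift x π i * (v 0 - v 1)) / L.p) 0) s ∈
      Set.Icc (-(δ / L.p)) 0 := by
    intro s
    have h0 : 0 ≤ δ / L.p := by positivity
    induction s using L.state_cases with
    | h2 k => simpa using h0
    | h1 i r =>
      rcases r with _ | z
      · have h1 := hx π i
        have h2 : 0 ≤ L.meanShift x π i * (v 0 - v 1) := mul_nonneg h1.1 hv.1
        have h3 : L.meanShift x π i * (v 0 - v 1) ≤ δ := by nlinarith [h1.1, h1.2, hv.2]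
        simp only [extend_st, Option.elim, neg_div]
        exact ⟨neg_le_neg (by gcongr), neg_nonpos.2 (by positivity)⟩
      · simpa using h0
  linarith [(hb s).2, (hb s').1]

theorem baseValue_mem (v : Fin 3 → ℝ) (hv : ∀ z, v z ∈ Set.Icc (0 : ℝ) 1) (π : StatPolicy S A)
    (i : Fin n) : L.baseValue v π i ∈ Set.Icc (0 : ℝ) 1 := by
  have h := L.sum_mix_mul (fun _ _ => 0) π i v
  have h0 : L.meanShift (fun _ _ => 0) π i = 0 := by simp [meanShift, Shift.coe_zero]
  rw [h0, zero_mul, add_zero] at h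
  rw [← h]
  refine ⟨Finset.sum_nonneg fun z _ => mul_nonneg (L.mix_nonneg _ π i z) (hv z).1, ?_⟩
  rw [← L.sum_mix (fun _ _ => 0) π i]
  exact Finset.sum_le_sum fun z _ => mul_le_of_le_one_right (L.mix_nonneg _ π i z) (hv z).2

theorem biasSpanBounded_of_returning (hp : 0 < (L.p : ℝ)) (hβ : (L.β : ℝ) = L.p)
    (x : Fin n → A → Shift) (v : Fin 3 → ℝ) (hv : ∀ z, v z ∈ Set.Icc (0 : ℝ) 1) {H : ℝ}
    (hx : ∀ π i, |L.meanShift x π i| ≤ 1) (hH : 8 / L.p ≤ H) :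
    BiasSpanBounded (L.kernel x) (L.reward v) H := by
  intro π s s'
  have hb : ∀ s, |bias (L.kernel x) (L.reward v) π s| ≤ 4 / L.p := by
    intro s
    rw [(L.gain_bias_of_returning hp hβ x v π).2]
    have h4 : (0 : ℝ) ≤ 4 / L.p := by positivity
    induction s using L.state_cases with
    | h2 k => simpa using h4
    | h1 i r =>
      have h1 := hx π i
      have h2 : |L.meanShift x π i * (v 0 - v 1)| ≤ 1 := by
        rw [abs_mul]
        have : |v 0 - v 1| ≤ 1 := abs_le.2 ⟨by linarith [(hv 0).1, (hv 1).2],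
          by linarith [(hv 0).2, (hv 1).1]⟩
        exact mul_le_one₀ h1 (abs_nonneg _) this
      have h5 := abs_le.1 h2
      rcases r with _ | z
      · simp only [extend_st, Option.elim]
        rw [abs_le, ← neg_div, div_le_div_iff₀ hp (by positivity),
          div_le_div_iff₀ (by positivity) hp]
        constructor <;> nlinarith
      · have h3 := L.baseValue_mem v hv π i
        have h6 := hv z
        simp only [extend_st, Option.elim]
        have e : (v z - (L.baseValue v π i + L.meanShift x π i * (v 0 - v 1) / 2)) / L.p +
            -(L.meanShift x π i * (v 0 - v 1)) / (4 * L.p) =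
            (v z - L.baseValue v π i - 3 / 4 * (L.meanShift x π i * (v 0 - v 1))) / L.p := by
          field_simp
          ring
        rw [e, abs_div, abs_of_pos hp]
        gcongr
        rw [abs_le]
        constructor <;> linarith [h3.1, h3.2, h6.1, h6.2, h5.1, h5.2]
  have h1 := (abs_le.1 (hb s)).2
  have h2 := (abs_le.1 (hb s')).1
  have h3 : 8 / (L.p : ℝ) = 4 / L.p + 4 / L.p := by ring
  linarith

end Chain

end Layout

/-! ### Values of mixtures and the design of the constraint -/

namespace Layout

set_option linter.unusedSectionVars false

variable {S A : Type} [Fintype S] [DecidableEq S] [Fintype A] [DecidableEq A] {n d : ℕ}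
  [NeZero n] (L : Layout S A n d)

theorem reward_mem (v : Fin 3 → unitInterval) (s : S) (a : A) :
    L.reward (fun z => (v z : ℝ)) s a ∈ Set.Icc (0 : ℝ) 1 := by
  induction s using L.state_cases with
  | h2 k => simp [reward]
  | h1 i r =>
    rcases r with _ | z
    · have h0 : ∀ z, 0 ≤ L.baseDist a z := fun z => by
        have := (L.exitDist_pos 0 a z).le
        simpa [exitDist, Shift.coe_zero] using this
      have h1 : ∑ z, L.baseDist a z = 1 := by
        have := L.sum_exitDist 0 a
        simpa [exitDist, Shift.coe_zero] using this
      simp only [reward, e_st]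
      refine ⟨Finset.sum_nonneg fun z _ => mul_nonneg (h0 z) (v z).2.1, ?_⟩
      rw [← h1]
      exact Finset.sum_le_sum fun z _ => mul_le_of_le_one_right (h0 z) (v z).2.2
    · simp [reward]

/-- The known part of the CAMDPs of the family; the initial distribution is uniform on the
decision states. -/
def task (rv cv : Fin 3 → unitInterval) (b : ℝ) : CTask S A where
  r := L.reward fun z => rv z
  c := L.reward fun z => cv z
  b := b
  init := (PMF.uniformOfFintype (Fin n)).map fun i => L.st i none
  r_mem := L.reward_mem rv
  c_mem := L.reward_mem cv

/-- A CAMDP of the family. -/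
def camdp (rv cv : Fin 3 → unitInterval) (b : ℝ) (x : Fin n → A → Shift) : CAMDP S A where
  toCTask := L.task rv cv b
  P := L.kernel x

/-- The action probabilities of a policy in the decision states. -/
def policyWeight (π : StatPolicy S A) (i : Fin n) (a : A) : ℝ := (π (L.st i none) a).toReal

/-- The mean action probabilities of a mixture in the decision states. -/
def mixWeight (w : MixedPolicy S A) (i : Fin n) (a : A) : ℝ :=
  ∑' π, (w π).toReal * L.policyWeight π i a

/-- Nonnegative weights that add up to one in every component. -/
structure IsWeight (ω : Fin n → A → ℝ) : Prop where
  nonneg : ∀ i a, 0 ≤ ω i a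
  sum_eq : ∀ i, ∑ a, ω i a = 1

theorem isWeight_policyWeight (π : StatPolicy S A) : IsWeight (L.policyWeight π) :=
  ⟨fun _ _ => ENNReal.toReal_nonneg, fun _ => PMF.sum_toReal _⟩

theorem IsWeight.le_one {ω : Fin n → A → ℝ} (h : IsWeight ω) (i : Fin n) (a : A) : ω i a ≤ 1 := by
  rw [← h.sum_eq i]
  exact Finset.single_le_sum (fun a _ => h.nonneg i a) (Finset.mem_univ a)

theorem summable_mixWeight (w : MixedPolicy S A) (i : Fin n) (a : A) :
    Summable fun π => (w π).toReal * L.policyWeight π i a := by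
  refine Summable.of_nonneg_of_le (fun π => mul_nonneg ENNReal.toReal_nonneg
    ENNReal.toReal_nonneg) (fun π => mul_le_of_le_one_right ENNReal.toReal_nonneg
    ((L.isWeight_policyWeight π).le_one i a)) (ENNReal.summable_toReal w.tsum_coe_ne_top)

theorem isWeight_mixWeight (w : MixedPolicy S A) : IsWeight (L.mixWeight w) := by
  refine ⟨fun i a => tsum_nonneg fun π => mul_nonneg ENNReal.toReal_nonneg ENNReal.toReal_nonneg,
    fun i => ?_⟩
  simp only [mixWeight]
  rw [← Summable.tsum_finsetSum fun a _ => L.summable_mixWeight w i a]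
  simp only [← Finset.mul_sum, (L.isWeight_policyWeight _).sum_eq, mul_one, PMF.tsum_toReal]

/-- The long-run value of given action probabilities in the decision states. -/
def payoff (γ : ℝ) (x : Fin n → A → Shift) (v : Fin 3 → unitInterval) (ω : Fin n → A → ℝ) : ℝ :=
  ∑ i, ∑ a, ω i a * ((∑ z, L.baseDist a z * v z + γ * x i a * (v 0 - v 1)) / n)

theorem sum_init (rv cv : Fin 3 → unitInterval) (b : ℝ) (g : S → ℝ) :
    ∑ s, ((L.task rv cv b).init s).toReal * g s = ∑ i, g (L.st i none) / n := by
  have h : ∀ s, ((L.task rv cv b).init s).toReal =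
      ∑ i, if s = L.st i none then (n : ℝ)⁻¹ else 0 := by
    intro s
    simp only [task, PMF.map_apply, tsum_fintype, PMF.uniformOfFintype_apply, Fintype.card_fin]
    rw [ENNReal.toReal_sum]
    · refine Finset.sum_congr rfl fun i _ => ?_
      split_ifs <;> simp
    · intro i _
      split_ifs <;> simp [NeZero.ne n]
  simp only [h, Finset.sum_mul]
  rw [Finset.sum_comm]
  refine Finset.sum_congr rfl fun i _ => ?_
  simp only [ite_mul, zero_mul, Finset.sum_ite_eq', Finset.mem_univ, if_true]
  ring

theorem sum_gain_eq_payoff {γ : ℝ} (hγ : L.IsFactor γ) (hp : 0 < (L.p : ℝ))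
    (x : Fin n → A → Shift) (v : Fin 3 → unitInterval) (π : StatPolicy S A) :
    ∑ i, gain (L.kernel x) (L.reward fun z => v z) π (L.st i none) / n =
      L.payoff γ x v (L.policyWeight π) := by
  refine Finset.sum_congr rfl fun i _ => ?_
  rw [L.gain_decision hγ hp]
  simp only [baseValue, meanShift, policyWeight, ← mul_div_assoc, ← Finset.sum_div]
  congr 1
  simp only [mul_add, Finset.sum_add_distrib]
  congr 1
  simp only [Finset.mul_sum, Finset.sum_mul]
  exact Finset.sum_congr rfl fun a _ => by ring

theorem valueR_camdp {γ : ℝ} (hγ : L.IsFactor γ) (hp : 0 < (L.p : ℝ)) (rv cv : Fin 3 → unitInterval)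
    (b : ℝ) (x : Fin n → A → Shift) (π : StatPolicy S A) :
    (L.camdp rv cv b x).valueR π = L.payoff γ x rv (L.policyWeight π) := by
  rw [← L.sum_gain_eq_payoff hγ hp, ← L.sum_init rv cv b]
  rfl

theorem valueC_camdp {γ : ℝ} (hγ : L.IsFactor γ) (hp : 0 < (L.p : ℝ)) (rv cv : Fin 3 → unitInterval)
    (b : ℝ) (x : Fin n → A → Shift) (π : StatPolicy S A) :
    (L.camdp rv cv b x).valueC π = L.payoff γ x cv (L.policyWeight π) := by
  rw [← L.sum_gain_eq_payoff hγ hp, ← L.sum_init rv cv b]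
  rfl

/-- The payoff is linear in the action probabilities, so a mixture can be replaced by its mean
weights. -/
theorem tsum_payoff (γ : ℝ) (x : Fin n → A → Shift) (v : Fin 3 → unitInterval)
    (w : MixedPolicy S A) :
    ∑' π, (w π).toReal * L.payoff γ x v (L.policyWeight π) = L.payoff γ x v (L.mixWeight w) := by
  simp only [payoff, mixWeight, Finset.mul_sum, ← mul_assoc, ← tsum_mul_right]
  rw [Summable.tsum_finsetSum]
  · refine Finset.sum_congr rfl fun i _ => ?_
    rw [Summable.tsum_finsetSum]
    exact fun a _ => (L.summable_mixWeight w i a).mul_right _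
  · exact fun i _ => summable_sum fun a _ => (L.summable_mixWeight w i a).mul_right _

theorem mixedR_camdp {γ : ℝ} (hγ : L.IsFactor γ) (hp : 0 < (L.p : ℝ)) (rv cv : Fin 3 → unitInterval)
    (b : ℝ) (x : Fin n → A → Shift) (w : MixedPolicy S A) :
    (L.camdp rv cv b x).mixedR w = L.payoff γ x rv (L.mixWeight w) := by
  simp only [CAMDP.mixedR, L.valueR_camdp hγ hp, tsum_payoff]

theorem mixedC_camdp {γ : ℝ} (hγ : L.IsFactor γ) (hp : 0 < (L.p : ℝ)) (rv cv : Fin 3 → unitInterval)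
    (b : ℝ) (x : Fin n → A → Shift) (w : MixedPolicy S A) :
    (L.camdp rv cv b x).mixedC w = L.payoff γ x cv (L.mixWeight w) := by
  simp only [CAMDP.mixedC, L.valueC_camdp hγ hp, tsum_payoff]

/-- The perturbation by `δ` of at most one hidden action in every component. -/
def hiddenShift (δ : Shift) (t : Fin n → Option A) (i : Fin n) (a : A) : Shift :=
  if t i = some a then δ else 0

/-- The average weight of the safe action. -/
def safeShare (ω : Fin n → A → ℝ) : ℝ := (∑ i, ω i L.safe) / n

/-- The average weight of the hidden actions. -/
def hitShare (t : Fin n → Option A) (ω : Fin n → A → ℝ) : ℝ :=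
  (∑ i, ∑ a, if t i = some a then ω i a else 0) / n

/-- The fraction of components with a hidden action. -/
def activeShare (t : Fin n → Option A) : ℝ := (∑ i, if (t i).isSome then 1 else 0) / n

/-- Only two averages of a policy matter, the safe share and the hit share, so the constrained
problem becomes a linear programme in two variables. -/
theorem payoff_hiddenShift (γ : ℝ) (δ : Shift) (t : Fin n → Option A) (v : Fin 3 → unitInterval)
    {ω : Fin n → A → ℝ} (hω : IsWeight ω) :
    L.payoff γ (hiddenShift δ t) v ω = 3 / 8 * (v 0 + v 1) + v 2 / 4 +
      L.safeShare ω * (v 2 / 4 - (v 0 + v 1) / 8) + γ * δ * (v 0 - v 1) * hitShare t ω := by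
  have hn : (n : ℝ) ≠ 0 := Nat.cast_ne_zero.2 (NeZero.ne n)
  have hbase : ∀ a, ∑ z, L.baseDist a z * v z = 3 / 8 * (v 0 + v 1) + v 2 / 4 +
      if a = L.safe then (v 2 / 4 - (v 0 + v 1) / 8 : ℝ) else 0 := by
    intro a
    by_cases h : a = L.safe <;> simp [baseDist, h, Fin.sum_univ_three] <;> ring
  have hshift : ∀ i a, ((hiddenShift δ t i a : Shift) : ℝ) =
      if t i = some a then (δ : ℝ) else 0 := by
    intro i a
    simp only [hiddenShift]
    split_ifs <;> rfl
  have hi : ∀ i, ∑ a, ω i a * ((∑ z, L.baseDist a z * v z +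
      γ * hiddenShift δ t i a * (v 0 - v 1)) / n) =
      (3 / 8 * (v 0 + v 1) + v 2 / 4) / n +
        ω i L.safe * ((v 2 / 4 - (v 0 + v 1) / 8) / n) +
        (∑ a, if t i = some a then ω i a else 0) * (γ * δ * (v 0 - v 1) / n) := by
    intro i
    have h1 : ∀ a, ω i a * ((∑ z, L.baseDist a z * v z +
        γ * hiddenShift δ t i a * (v 0 - v 1)) / n) =
        ω i a * ((3 / 8 * (v 0 + v 1) + v 2 / 4) / n) +
        (if a = L.safe then ω i a * ((v 2 / 4 - (v 0 + v 1) / 8) / n) else 0) +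
        (if t i = some a then ω i a else 0) * (γ * δ * (v 0 - v 1) / n) := by
      intro a
      rw [hbase, hshift]
      split_ifs <;> ring
    simp only [h1, Finset.sum_add_distrib, ← Finset.sum_mul, hω.sum_eq, Finset.sum_ite_eq',
      Finset.mem_univ, if_true, one_mul]
  simp only [payoff, hi, Finset.sum_add_distrib, ← Finset.sum_mul, safeShare, hitShare]
  simp
  field_simp

theorem shares_nonneg (t : Fin n → Option A) {ω : Fin n → A → ℝ} (hω : IsWeight ω) :
    0 ≤ L.safeShare ω ∧ 0 ≤ hitShare t ω := by
  constructor
  · exact div_nonneg (Finset.sum_nonneg fun i _ => hω.nonneg i _) (Nat.cast_nonneg _)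
  · refine div_nonneg (Finset.sum_nonneg fun i _ => Finset.sum_nonneg fun a _ => ?_)
      (Nat.cast_nonneg _)
    split_ifs
    exacts [hω.nonneg i a, le_rfl]

theorem safeShare_add_hitShare_le (t : Fin n → Option A) (ht : ∀ i, t i ≠ some L.safe)
    {ω : Fin n → A → ℝ} (hω : IsWeight ω) : L.safeShare ω + hitShare t ω ≤ 1 := by
  have hn : (0 : ℝ) < n := Nat.cast_pos.2 (Nat.pos_of_ne_zero (NeZero.ne n))
  rw [safeShare, hitShare, ← add_div, div_le_one hn, ← Finset.sum_add_distrib]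
  calc _ ≤ ∑ i : Fin n, (1 : ℝ) := by
        refine Finset.sum_le_sum fun i _ => ?_
        rw [← hω.sum_eq i]
        have : ω i L.safe = ∑ a, if a = L.safe then ω i a else 0 := by simp
        rw [this, ← Finset.sum_add_distrib]
        refine Finset.sum_le_sum fun a _ => ?_
        have h1 := ht i
        have h2 := hω.nonneg i a
        split_ifs with h3 h4
        · subst h3; exact absurd h4 h1
        all_goals linarith
    _ = n := by simp

/-- The policy that plays the hidden actions and, in the components without one, the safe action
with probability `σ` and a fixed arm otherwise. -/
def comparator (t : Fin n → Option A) (σ : unitInterval) (arm : A) : StatPolicy S A := fun s =>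
  match L.e s with
  | Sum.inl (i, _) => match t i with
    | some a => PMF.pure a
    | none => PMF.ofFintype (fun a => (if a = L.safe then ENNReal.ofReal σ else 0) +
        if a = arm then ENNReal.ofReal (1 - σ) else 0) (by
          simp only [Finset.sum_add_distrib, Finset.sum_ite_eq', Finset.mem_univ, if_true]
          rw [← ENNReal.ofReal_add σ.2.1 (by linarith [σ.2.2])]
          simp)
  | Sum.inr _ => PMF.pure L.safe

theorem comparator_shares (t : Fin n → Option A) (ht : ∀ i, t i ≠ some L.safe) (σ : unitInterval)
    {arm : A} (harm : arm ≠ L.safe) :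
    hitShare t (L.policyWeight (L.comparator t σ arm)) = activeShare t ∧
    L.safeShare (L.policyWeight (L.comparator t σ arm)) = σ * (1 - activeShare t) := by
  have hn : (n : ℝ) ≠ 0 := Nat.cast_ne_zero.2 (NeZero.ne n)
  constructor
  · simp only [hitShare, activeShare]
    congr 1
    refine Finset.sum_congr rfl fun i _ => ?_
    rcases h : t i with _ | a
    · simp
    · simp [policyWeight, comparator, h]
  · have : ∀ i, L.policyWeight (L.comparator t σ arm) i L.safe =
        σ * (1 - if (t i).isSome then 1 else 0) := by
      intro i
      rcases h : t i with _ | a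
      · simp [policyWeight, comparator, h, harm.symm, σ.2.1]
      · have : L.safe ≠ a := by
          rintro rfl
          exact ht i h
        simp [policyWeight, comparator, h, this]
    simp only [safeShare, this, activeShare, ← Finset.mul_sum, Finset.sum_sub_distrib]
    simp
    field_simp

theorem safe_shares (t : Fin n → Option A) (ht : ∀ i, t i ≠ some L.safe) :
    hitShare t (L.policyWeight fun _ => PMF.pure L.safe) = 0 ∧
    L.safeShare (L.policyWeight fun _ => PMF.pure L.safe) = 1 := by
  have hn : (n : ℝ) ≠ 0 := Nat.cast_ne_zero.2 (NeZero.ne n)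
  constructor
  · simp only [hitShare]
    rw [Finset.sum_eq_zero, zero_div]
    intro i _
    refine Finset.sum_eq_zero fun a _ => ?_
    split_ifs with h
    · have : a ≠ L.safe := by
        rintro rfl
        exact ht i h
      simp [policyWeight, this]
    · rfl
  · simp [safeShare, policyWeight, hn]

theorem activeShare_mem (t : Fin n → Option A) : activeShare t ∈ Set.Icc (0 : ℝ) 1 := by
  have hn : (0 : ℝ) < n := Nat.cast_pos.2 (Nat.pos_of_ne_zero (NeZero.ne n))
  constructor
  · exact div_nonneg (Finset.sum_nonneg fun i _ => by split_ifs <;> norm_num) hn.le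
  · rw [activeShare, div_le_one hn]
    calc _ ≤ ∑ i : Fin n, (1 : ℝ) := Finset.sum_le_sum fun i _ => by split_ifs <;> norm_num
      _ = n := by simp

/-- There is a task such that, whatever the hidden actions are, the Slater constant is `ζ` and all
strictly feasible nearly optimal mixtures play most hidden actions. -/
theorem exists_task {γ : ℝ} (hγ : L.IsFactor γ) (hp : 0 < (L.p : ℝ)) {arm : A}
    (harm : arm ≠ L.safe) {ζ ε : ℝ} (hζ : 0 < ζ) (hε : 0 < ε) (hε' : ε ≤ 1 / 256)
    (δ : Shift) (hδ : (δ : ℝ) = 32 * ε * ζ) :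
    ∃ (rv cv : Fin 3 → unitInterval) (b : ℝ),
      (rv 0 - rv 1 : ℝ) ∈ Set.Icc 0 1 ∧ (cv 0 - cv 1 : ℝ) ∈ Set.Icc 0 1 ∧
      ∀ t : Fin n → Option A, (∀ i, t i ≠ some L.safe) →
        (L.camdp rv cv b (hiddenShift δ t)).HasSlater ζ ∧
        ∀ w ∈ (L.camdp rv cv b (hiddenShift δ t)).strictlyOptimal (ε / 24),
          activeShare t - hitShare t (L.mixWeight w) ≤ 1 / 12 := by
  have hγ' : 1 / 2 ≤ γ ∧ γ ≤ 1 := by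
    rcases hγ with ⟨_, rfl⟩ | ⟨_, rfl⟩ <;> norm_num
  have hD1 : 16 * ε * ζ ≤ γ * δ := by
    rw [hδ]
    nlinarith [mul_pos hε hζ, hγ'.1]
  have hD2 : γ * δ ≤ 1 / 8 := by
    have := δ.2.2
    have h0 : (0 : ℝ) ≤ δ := by rw [hδ]; positivity
    nlinarith [hγ'.2]
  let rv : Fin 3 → unitInterval := ![1, 0, 0]
  have hεζ := mul_pos hε hζ
  -- The threshold `1 / 8` keeps the third constraint value `1 / 4 + 4 * ζ + 2 * (γ * δ)` at most
  -- `1`.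
  rcases le_or_gt ζ (1 / 8) with hζ' | hζ'
  · have hy : 1 / 4 + 4 * ζ + 2 * (γ * δ) ∈ Set.Icc (0 : ℝ) 1 :=
      ⟨by linarith, by linarith⟩
    -- With safe share `s`, hit share `h` and `D = γ * δ`, these values and the threshold below give
    -- the slack `s * ζ - D / 2 * (1 - s - h)`: it is `ζ` for the safe policy, at most `ζ` always,
    -- and weight on neither safe nor hidden actions is penalised.
    let cv : Fin 3 → unitInterval := ![⟨1 / 2, by norm_num⟩, 0, ⟨_, hy⟩]
    have hcv2 : ((cv 2 : unitInterval) : ℝ) = 1 / 4 + 4 * ζ + 2 * (γ * δ) := rfl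
    have hcv0 : ((cv 0 : unitInterval) : ℝ) = 1 / 2 := rfl
    have hcv1 : ((cv 1 : unitInterval) : ℝ) = 0 := rfl
    refine ⟨rv, cv, 1 / 4 + ζ + γ * δ, by simp [rv], by norm_num [hcv0, hcv1], fun t ht => ?_⟩
    have hR : ∀ ω, IsWeight ω → L.payoff γ (hiddenShift δ t) rv ω =
        3 / 8 - L.safeShare ω / 8 + γ * δ * hitShare t ω := by
      intro ω hω
      rw [L.payoff_hiddenShift γ δ t rv hω]
      simp [rv]
      ring
    have hC : ∀ ω, IsWeight ω → L.payoff γ (hiddenShift δ t) cv ω - (1 / 4 + ζ + γ * δ) =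
        L.safeShare ω * (ζ + γ * δ / 2) + γ * δ / 2 * hitShare t ω - γ * δ / 2 := by
      intro ω hω
      rw [L.payoff_hiddenShift γ δ t cv hω, hcv0, hcv1, hcv2]
      ring
    clear_value cv
    clear hcv2 hy
    generalize γ * (δ : ℝ) = D at hR hC hD1 hD2 ⊢
    constructor
    · constructor
      · refine ⟨fun _ => PMF.pure L.safe, ?_⟩
        have := L.safe_shares t ht
        simp only [L.valueC_camdp hγ hp]
        refine (hC _ (L.isWeight_policyWeight _)).trans ?_
        rw [this.1, this.2]
        ring
      · rintro _ ⟨π, rfl⟩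
        simp only [L.valueC_camdp hγ hp]
        refine (hC _ (L.isWeight_policyWeight _)).trans_le ?_
        have h1 := L.safeShare_add_hitShare_le t ht (L.isWeight_policyWeight π)
        have h2 := L.shares_nonneg t (L.isWeight_policyWeight π)
        nlinarith [h2.1, h2.2]
    · rintro w ⟨hw1, hw2⟩
      rw [L.mixedC_camdp hγ hp] at hw1
      have hw1' := hC _ (L.isWeight_mixWeight w)
      replace hw1 : 1 / 4 + ζ + D ≤ L.payoff γ (hiddenShift δ t) cv (L.mixWeight w) := hw1
      have hDpos : 0 < D := by nlinarith
      -- This is the safe probability `σ` at which a component without a hidden action has slack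
      -- zero; the comparator with this `σ` meets the constraint with equality.
      have hσ : D / 2 / (D / 2 + ζ) ∈ Set.Icc (0 : ℝ) 1 :=
        ⟨by positivity, by rw [div_le_one (by positivity)]; linarith⟩
      have hσe : D / 2 / (D / 2 + ζ) * (D / 2 + ζ) = D / 2 := div_mul_cancel₀ _ (by positivity)
      have hσ4 : 4 * ε ≤ D / 2 / (D / 2 + ζ) := by
        rw [le_div_iff₀ (by positivity)]
        nlinarith
      have hcmp := L.comparator_shares t ht ⟨_, hσ⟩ harm
      have hfeas := hC _ (L.isWeight_policyWeight (L.comparator t ⟨_, hσ⟩ arm))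
      rw [hcmp.1, hcmp.2] at hfeas
      have h2 := hw2 (L.comparator t ⟨_, hσ⟩ arm) (by
        rw [L.valueC_camdp hγ hp]
        change 1 / 4 + ζ + D ≤ _
        simp only at hfeas
        rw [← sub_nonneg, hfeas]
        have : D / 2 / (D / 2 + ζ) * (1 - activeShare t) * (ζ + D / 2) =
          D / 2 * (1 - activeShare t) := by rw [mul_right_comm, add_comm ζ, hσe]
        rw [this]
        linarith)
      rw [L.valueR_camdp hγ hp, L.mixedR_camdp hγ hp, hR _ (L.isWeight_policyWeight _),
        hR _ (L.isWeight_mixWeight w), hcmp.1, hcmp.2] at h2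
      simp only at h2
      clear hfeas hcmp
      generalize D / 2 / (D / 2 + ζ) = σ at hσe hσ4 h2
      generalize L.safeShare (L.mixWeight w) = s at hw1' h2
      generalize hitShare t (L.mixWeight w) = h at hw1' h2 ⊢
      generalize activeShare t = q at h2 ⊢
      -- Feasibility forces this much safe play in exchange for missed hidden actions.
      have h3 : σ * (1 - h) ≤ s := by
        have h4 : σ * (1 - h) * (D / 2 + ζ) ≤ s * (D / 2 + ζ) := by
          rw [mul_right_comm, hσe]
          linarith
        exact le_of_mul_le_mul_right h4 (by positivity)
      -- Relative to the comparator, the mixture loses at least `(D + σ / 8) * (q - h) ≥ ε / 2 * (q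
      -- - h)`, which would exceed `ε / 24`.
      by_contra hu
      push Not at hu
      nlinarith [mul_pos hDpos (show 0 < q - h by linarith), mul_lt_mul_of_pos_left hu hε,
        mul_le_mul_of_nonneg_right hσ4 (show 0 ≤ q - h by linarith)]
  -- For `ζ > 1 / 8` every policy has constraint value `1` and slack `ζ`. The reward alone suffices,
  -- since `D ≥ 16 * ε * ζ > 2 * ε`.
  · let cv : Fin 3 → unitInterval := fun _ => 1
    refine ⟨rv, cv, 1 - ζ, by simp [rv], by simp [cv], fun t ht => ?_⟩
    have hR : ∀ ω, IsWeight ω → L.payoff γ (hiddenShift δ t) rv ω =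
        3 / 8 - L.safeShare ω / 8 + γ * δ * hitShare t ω := by
      intro ω hω
      rw [L.payoff_hiddenShift γ δ t rv hω]
      simp [rv]
      ring
    have hC : ∀ ω, IsWeight ω → L.payoff γ (hiddenShift δ t) cv ω = 1 := by
      intro ω hω
      rw [L.payoff_hiddenShift γ δ t cv hω]
      simp [cv]
      ring
    have hval : ∀ π, (L.camdp rv cv (1 - ζ) (hiddenShift δ t)).valueC π -
        (L.camdp rv cv (1 - ζ) (hiddenShift δ t)).b = ζ := by
      intro π
      rw [L.valueC_camdp hγ hp, hC _ (L.isWeight_policyWeight _)]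
      change 1 - (1 - ζ) = ζ
      ring
    constructor
    · constructor
      · exact ⟨fun _ => PMF.pure L.safe, hval _⟩
      · rintro _ ⟨π, rfl⟩
        exact (hval π).le
    · rintro w ⟨-, hw2⟩
      have hcmp := L.comparator_shares t ht 0 harm
      have h2 := hw2 (L.comparator t 0 arm) (by linarith [hval (L.comparator t 0 arm)])
      rw [L.valueR_camdp hγ hp, L.mixedR_camdp hγ hp, hR _ (L.isWeight_policyWeight _),
        hR _ (L.isWeight_mixWeight w), hcmp.1, hcmp.2] at h2
      have h3 := (L.shares_nonneg t (L.isWeight_mixWeight w)).1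
      simp only [Set.Icc.coe_zero, zero_mul] at h2
      generalize γ * (δ : ℝ) = D at *
      by_contra hu
      push Not at hu
      nlinarith

end Layout

/-! ### Averaging over hidden patterns -/

section Averaging

/-- Exchanging the coordinate `f i` with `τ` is an involution, so resampling one coordinate
preserves the uniform measure. -/
theorem sum_sum_update {n : ℕ} {T : Type*} [Fintype T] (i : Fin n) (φ : (Fin n → T) → ℝ) :
    ∑ f, ∑ τ, φ (Function.update f i τ) = Fintype.card T * ∑ f, φ f := by
  let E : (Fin n → T) × T ≃ (Fin n → T) × T :=
    { toFun := fun y => (Function.update y.1 i y.2, y.1 i)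
      invFun := fun y => (Function.update y.1 i y.2, y.1 i)
      left_inv := fun y => by simp
      right_inv := fun y => by simp }
  have h := E.sum_comp fun y => φ y.1
  rw [Fintype.sum_prod_type, Fintype.sum_prod_type] at h
  rw [show ∑ f, ∑ τ, φ (Function.update f i τ) = _ from h]
  simp [Finset.mul_sum]

/-- Averaging over hidden choices in `n` coordinates: if the loss `e` of guessing a hidden choice
is small for every pattern of choices, and removing one choice changes its loss by little unless
the effort `N` spent on it is large, then the total effort is large for some pattern. -/
theorem le_mul_of_loss_le {n : ℕ} [NeZero n] {R : Type*} [Fintype R] [Nonempty R]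
    (e N : (Fin n → Option R) → Fin n → R → ℝ) {c X : ℝ} (hc : 0 ≤ c)
    (hN : ∀ t i a, 0 ≤ N t i a)
    (hstep : ∀ (t : Fin n → Option R) i a, t i = none →
      2 * e t i a ≤ e (Function.update t i (some a)) i a + 1 + c * N t i a)
    (hguess : ∀ t i, (Fintype.card R : ℝ) - 1 ≤ ∑ a, e t i a)
    (hX : ∀ t, ∑ i, ∑ a, N t i a ≤ X)
    (hloss : ∀ t : Fin n → Option R, ∑ i, (t i).elim 0 (e t i) ≤ n / 3) :
    n * (Fintype.card R / 6 - 1 : ℝ) ≤ c * X := by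
  set k : ℝ := (Fintype.card R : ℝ) with hk
  have hk0 : 0 < k := Nat.cast_pos.2 Fintype.card_pos
  -- Each component gets a hidden choice with probability `1 / 2`. The coin is needed because the
  -- effort in `hstep` is measured under the pattern with that choice removed, so such patterns must
  -- carry weight too.
  let hid : (Fin n → Bool × R) → Fin n → Option R := fun f i =>
    if (f i).1 then some (f i).2 else none
  have hupd : ∀ f i τ, hid (Function.update f i τ) =
      Function.update (hid f) i (if τ.1 then some τ.2 else none) := by
    intro f i τ
    funext j
    by_cases h : j = i
    · subst h; simp [hid]
    · simp [hid, h]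
  set M : ℝ := (Fintype.card (Fin n → Bool × R) : ℝ) with hM
  have hM0 : 0 < M := Nat.cast_pos.2 Fintype.card_pos
  -- Resampling only component `i`: summing `hstep` over the choices and inserting `hguess` leaves
  -- `2 * (k - 1) - k`. The factor `c / k` compensates for the `k` copies of the pattern without a
  -- choice.
  have hpoint : ∀ f i, k - 2 ≤
      ∑ τ, ((hid (Function.update f i τ) i).elim 0 (e (hid (Function.update f i τ)) i) +
        c / k * ∑ a, N (hid (Function.update f i τ)) i a) := by
    intro f i
    simp only [hupd, Finset.sum_add_distrib, ← Finset.mul_sum]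
    rw [Fintype.sum_prod_type, Fintype.sum_prod_type]
    simp only [Fintype.sum_bool, if_true, Function.update_self, Option.elim, Bool.false_eq_true,
      if_false, Finset.sum_const_zero, add_zero, Finset.sum_const, Finset.card_univ, nsmul_eq_mul]
    set t₀ := Function.update (hid f) i none with ht₀
    have h1 : ∀ a, Function.update t₀ i (some a) = Function.update (hid f) i (some a) := by
      intro a; simp [ht₀]
    have h2 : ∀ a, 2 * e t₀ i a ≤ e (Function.update (hid f) i (some a)) i a + 1 + c * N t₀ i a := by
      intro a
      have := hstep t₀ i a (by simp [ht₀])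
      rwa [h1] at this
    have h3 := Finset.sum_le_sum fun a (_ : a ∈ Finset.univ) => h2 a
    simp only [Finset.sum_add_distrib, ← Finset.mul_sum, Finset.sum_const, Finset.card_univ,
      nsmul_eq_mul, mul_one] at h3
    have h4 := hguess t₀ i
    have h5 : 0 ≤ ∑ x : R, ∑ a, N (Function.update (hid f) i (some x)) i a :=
      Finset.sum_nonneg fun _ _ => Finset.sum_nonneg fun _ _ => hN _ _ _
    have h6 : c / k * (∑ x : R, ∑ a, N (Function.update (hid f) i (some x)) i a +
        k * ∑ a, N t₀ i a) = c / k * (∑ x : R, ∑ a, N (Function.update (hid f) i (some x)) i a) +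
        c * ∑ a, N t₀ i a := by
      field_simp
    rw [h6]
    have h7 := mul_nonneg (div_nonneg hc hk0.le) h5
    linarith
  have hi : ∀ i, M * (k - 2) ≤ 2 * k *
      ∑ f, ((hid f i).elim 0 (e (hid f) i) + c / k * ∑ a, N (hid f) i a) := by
    intro i
    have h1 := sum_sum_update i fun f : Fin n → Bool × R =>
      (hid f i).elim 0 (e (hid f) i) + c / k * ∑ a, N (hid f) i a
    have h2 : (Fintype.card (Bool × R) : ℝ) = 2 * k := by
      rw [Fintype.card_prod, Fintype.card_bool]; push_cast; ring
    rw [h2] at h1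
    rw [← h1]
    calc M * (k - 2) = ∑ f : Fin n → Bool × R, (k - 2) := by
          rw [Finset.sum_const, Finset.card_univ, nsmul_eq_mul]
      _ ≤ _ := Finset.sum_le_sum fun f _ => hpoint f i
  have htot : n * (M * (k - 2)) ≤ 2 * k * (M * (n / 3 + c / k * X)) := by
    calc n * (M * (k - 2)) = ∑ i : Fin n, M * (k - 2) := by simp
      _ ≤ ∑ i, 2 * k * ∑ f, ((hid f i).elim 0 (e (hid f) i) + c / k * ∑ a, N (hid f) i a) :=
        Finset.sum_le_sum fun i _ => hi i
      _ = 2 * k * ∑ f, (∑ i, (hid f i).elim 0 (e (hid f) i) +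
          c / k * ∑ i, ∑ a, N (hid f) i a) := by
        rw [← Finset.mul_sum, Finset.sum_comm]
        simp only [Finset.sum_add_distrib, Finset.mul_sum]
      _ ≤ 2 * k * ∑ f : Fin n → Bool × R, (n / 3 + c / k * X) := by
        gcongr with f
        · exact hloss _
        · exact hX _
      _ = _ := by rw [Finset.sum_const, Finset.card_univ, nsmul_eq_mul]
  have h8 : M * (n * (k - 2)) ≤ M * (2 * k * (n / 3) + 2 * (c * X)) := by
    calc M * (n * (k - 2)) = n * (M * (k - 2)) := by ring
      _ ≤ _ := htot
      _ = _ := by field_simp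
  have h9 := le_of_mul_le_mul_left h8 hM0
  linarith

end Averaging

/-! ### The cost of finding hidden actions -/

namespace Layout

set_option linter.unusedSectionVars false

variable {S A : Type} [Fintype S] [DecidableEq S] [Fintype A] [DecidableEq A] {n d : ℕ}
  (L : Layout S A n d)

/-- The sign of the effect of a perturbation of action `a` in component `i`. -/
def sensitivity (i : Fin n) (a : A) (s : S) (b : A) (s' : S) : ℝ :=
  if s = L.st i none ∧ b = a then
    (if s' = L.st i (some 0) then 1 else if s' = L.st i (some 1) then -1 else 0) else 0

/-- Non-safe actions reach both affected outcomes with the same conditional probability `3 / 8`, so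
the additive shift becomes a multiplicative factor that is symmetric in the sign; `8 / 3` is the
reciprocal. -/
theorem trans_perturb (x : Fin n → A → Shift) (i : Fin n) {a : A} (ha : a ≠ L.safe)
    (hx : x i a = 0) (η : Shift) (s : S) (b : A) (s' : S) :
    L.trans (fun j c => if j = i ∧ c = a then η else x j c) s b s' =
      L.trans x s b s' * (1 + 8 / 3 * η * L.sensitivity i a s b s') := by
  by_cases h : s = L.st i none ∧ b = a
  · obtain ⟨rfl, rfl⟩ := h
    simp only [sensitivity, true_and, if_true]
    induction s' using L.state_cases with
    | h2 k => simp [trans]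
    | h1 j r =>
      by_cases hj : j = i
      · subst hj
        simp only [trans, e_st, if_true, hx, true_and]
        rcases r with _ | z
        · simp [jump, st]
        · fin_cases z <;> simp [jump, st, exitDist, baseDist, ha, Shift.coe_zero] <;> ring
      · simp [trans, hj]
  · have h0 : L.sensitivity i a s b s' = 0 := if_neg h
    rw [h0, mul_zero, add_zero, mul_one]
    induction s using L.state_cases with
    | h2 k =>
      simp only [trans, e_dummy]
      rcases L.e s' with ⟨l, r⟩ | k <;> rfl
    | h1 j r =>
      rcases r with _ | z
      · have h' : ¬(j = i ∧ b = a) := by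
          rintro ⟨rfl, rfl⟩
          exact h ⟨rfl, rfl⟩
        simp only [trans, e_st]
        rcases L.e s' with ⟨l, r⟩ | k
        · simp [h']
        · rfl
      · simp only [trans, e_st]
        rcases L.e s' with ⟨l, r⟩ | k
        · rcases r with _ | z' <;> simp [jump]
        · rfl

theorem kernel_perturb (x : Fin n → A → Shift) (i : Fin n) {a : A} (ha : a ≠ L.safe)
    (hx : x i a = 0) (η : Shift) (s : S) (b : A) (s' : S) :
    L.kernel (fun j c => if j = i ∧ c = a then η else x j c) s b s' =
      L.kernel x s b s' * ENNReal.ofReal (1 + 8 / 3 * η * L.sensitivity i a s b s') := by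
  rw [kernel_apply, kernel_apply, ← ENNReal.ofReal_mul (L.trans_nonneg _ _ _ _),
    L.trans_perturb x i ha hx]

/-- Only samples of this action in this decision state are informative; `16 / 3` is `(3 / 8 + 3 / 8)
* (8 / 3) ^ 2`. -/
theorem sum_kernel_sensitivity (x : Fin n → A → Shift) (i : Fin n) {a : A} (ha : a ≠ L.safe)
    (hx : x i a = 0) (η : ℝ) (q : S × A) :
    ∑' s', L.kernel x q.1 q.2 s' *
        ENNReal.ofReal ((8 / 3 * η * L.sensitivity i a q.1 q.2 s') ^ 2) =
      if q = (L.st i none, a) then ENNReal.ofReal (16 / 3 * L.p * η ^ 2) else 0 := by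
  simp only [kernel_apply, ← ENNReal.ofReal_mul (L.trans_nonneg _ _ _ _)]
  rw [tsum_fintype, ← ENNReal.ofReal_sum_of_nonneg fun s' _ =>
    mul_nonneg (L.trans_nonneg _ _ _ _) (sq_nonneg _)]
  split_ifs with h
  · subst h
    congr 1
    rw [L.sum_trans_st]
    simp [Fintype.sum_option, Fin.sum_univ_three, jump, sensitivity, st, hx, exitDist, baseDist,
      ha, Shift.coe_zero]
    ring
  · have h0 : ∀ s', L.sensitivity i a q.1 q.2 s' = 0 := fun s' =>
      if_neg fun h' => h (Prod.ext h'.1 h'.2)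
    simp [h0]

/-- Revealing a hidden action costs many samples of that action. -/
theorem two_mul_expect_le_of_hidden (alg : Sampler S A) (δ : Shift) (t : Fin n → Option A)
    (i : Fin n) {a : A} (ha : a ≠ L.safe) (ht : t i = none) (F : MixedPolicy S A → ENNReal)
    (hF : ∀ w, F w ≤ 1) :
    2 * alg.expect (L.kernel (hiddenShift δ t)) F ≤
      alg.expect (L.kernel (hiddenShift δ (Function.update t i (some a)))) F + 1 +
      2 * (alg.pairSamples (L.kernel (hiddenShift δ t)) (L.st i none, a) *
        ENNReal.ofReal (16 / 3 * L.p * δ ^ 2)) := by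
  have hx : hiddenShift δ t i a = 0 := by simp [hiddenShift, ht]
  have hupd : hiddenShift δ (Function.update t i (some a)) =
      fun j c => if j = i ∧ c = a then δ else hiddenShift δ t j c := by
    funext j c
    by_cases hj : j = i
    · subst hj
      by_cases hc : c = a
      · simp [hiddenShift, hc]
      · simp [hiddenShift, hc, ht, Ne.symm hc]
    · simp [hiddenShift, hj]
  have h := alg.two_mul_expect_le (L.kernel (hiddenShift δ t))
    (L.kernel (hiddenShift δ (Function.update t i (some a))))
    -- The auxiliary opposite perturbation has a harmful action in place of the hidden one; no
    -- correctness of the algorithm is required there.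
    (L.kernel (fun j c => if j = i ∧ c = a then -δ else hiddenShift δ t j c))
    (fun s b s' => 8 / 3 * δ * L.sensitivity i a s b s') (fun s b s' => by
      have h1 : |L.sensitivity i a s b s'| ≤ 1 := by
        unfold sensitivity
        split_ifs <;> simp
      have h2 : |(8 / 3 * δ : ℝ)| ≤ 1 := abs_le.2 ⟨by linarith [δ.2.1], by linarith [δ.2.2]⟩
      rw [abs_mul]
      exact mul_le_one₀ h2 (abs_nonneg _) h1)
    (fun s b s' => by rw [hupd, L.kernel_perturb _ i ha hx])
    (fun s b s' => by
      rw [L.kernel_perturb _ i ha hx, Shift.coe_neg]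
      congr 2
      ring) F hF
  refine h.trans (add_le_add le_rfl ?_)
  simp only [L.sum_kernel_sensitivity _ i ha hx, mul_ite, mul_zero]
  rw [tsum_ite_eq]

variable [NeZero n]

theorem meanShift_hiddenShift_mem (δ : Shift) (hδ : 0 ≤ (δ : ℝ)) (t : Fin n → Option A)
    (π : StatPolicy S A) (i : Fin n) :
    L.meanShift (hiddenShift δ t) π i ∈ Set.Icc (0 : ℝ) δ := by
  have h : ∀ a, ((hiddenShift δ t i a : Shift) : ℝ) ∈ Set.Icc (0 : ℝ) δ := by
    intro a
    simp only [hiddenShift]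
    split_ifs
    · exact ⟨hδ, le_rfl⟩
    · exact ⟨le_rfl, hδ⟩
  refine ⟨Finset.sum_nonneg fun a _ => mul_nonneg ENNReal.toReal_nonneg (h a).1, ?_⟩
  calc L.meanShift (hiddenShift δ t) π i ≤ ∑ a, (π (L.st i none) a).toReal * δ :=
        Finset.sum_le_sum fun a _ => mul_le_mul_of_nonneg_left (h a).2 ENNReal.toReal_nonneg
    _ = δ := by rw [← Finset.sum_mul, PMF.sum_toReal, one_mul]

theorem camdp_mem_problemClass {B H ζ : ℝ} (hp : 0 < (L.p : ℝ)) (hp1 : (L.p : ℝ) < 1)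
    (rv cv : Fin 3 → unitInterval) (b : ℝ) (δ : Shift) (hδ : 0 ≤ (δ : ℝ))
    (hL : ((L.β : ℝ) = 0 ∧ 1 / (L.p : ℝ) ≤ B ∧ (δ : ℝ) / L.p ≤ H) ∨
      ((L.β : ℝ) = L.p ∧ 8 / (L.p : ℝ) ≤ H))
    (hrv : (rv 0 - rv 1 : ℝ) ∈ Set.Icc 0 1) (hcv : (cv 0 - cv 1 : ℝ) ∈ Set.Icc 0 1)
    (t : Fin n → Option A) (hS : (L.camdp rv cv b (hiddenShift δ t)).HasSlater ζ) :
    L.camdp rv cv b (hiddenShift δ t) ∈ CAMDP.problemClass S A B H ζ := by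
  have hm := L.meanShift_hiddenShift_mem δ hδ t
  rcases hL with ⟨hβ, hB, hH⟩ | ⟨hβ, hH⟩
  · exact ⟨fun _ s => (L.expectedTransientTime_le_of_absorbing hp hβ _ _ s).trans
      (ENNReal.ofReal_le_ofReal hB),
      L.biasSpanBounded_of_absorbing hp hβ _ _ hrv hδ hm hH,
      L.biasSpanBounded_of_absorbing hp hβ _ _ hcv hδ hm hH, hS⟩
  · have hm1 : ∀ π i, |L.meanShift (hiddenShift δ t) π i| ≤ 1 := fun π i =>
      abs_le.2 ⟨by linarith [(hm π i).1], by linarith [(hm π i).2, δ.2.2]⟩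
    refine ⟨fun _ s => ?_, L.biasSpanBounded_of_returning hp hβ _ _ (fun z => (rv z).2) hm1 hH,
      L.biasSpanBounded_of_returning hp hβ _ _ (fun z => (cv z).2) hm1 hH, hS⟩
    exact (expectedTransientTime_of_isRecurrent
      (L.isRecurrent_of_returning hp hp1 hβ _ _ s)).trans_le zero_le

/-- The weight that a mixture does not give to an action. -/
def missWeight (i : Fin n) (a : A) (w : MixedPolicy S A) : ENNReal :=
  ENNReal.ofReal (1 - L.mixWeight w i a)

theorem missWeight_le_one (i : Fin n) (a : A) (w : MixedPolicy S A) : L.missWeight i a w ≤ 1 := by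
  rw [missWeight, ENNReal.ofReal_le_one]
  linarith [(L.isWeight_mixWeight w).nonneg i a]

/-- The weights in one component add up to at most `1` over the non-safe actions, so a mixture
cannot guess more than one of them. -/
theorem le_sum_missWeight (i : Fin n) (w : MixedPolicy S A) :
    ENNReal.ofReal (Fintype.card {a // a ≠ L.safe} - 1) ≤
      ∑ a : {a // a ≠ L.safe}, L.missWeight i a w := by
  have hw := L.isWeight_mixWeight w
  simp only [missWeight]
  rw [← ENNReal.ofReal_sum_of_nonneg fun a _ => sub_nonneg.2 (hw.le_one i _)]
  apply ENNReal.ofReal_le_ofReal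
  have h1 : ∑ a : {a // a ≠ L.safe}, L.mixWeight w i a ≤ 1 := by
    rw [← hw.sum_eq i, ← Fintype.sum_subtype_add_sum_subtype (fun a => a ≠ L.safe)]
    exact le_add_of_nonneg_right (Finset.sum_nonneg fun a _ => hw.nonneg i a)
  rw [Finset.sum_sub_distrib]
  simp only [Finset.sum_const, Finset.card_univ, nsmul_eq_mul, mul_one]
  linarith

theorem sum_missWeight (t : Fin n → Option A) (w : MixedPolicy S A) :
    ∑ i, (t i).elim 0 (fun a => L.missWeight i a w) =
      ENNReal.ofReal (n * (activeShare t - hitShare t (L.mixWeight w))) := by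
  have hn : (n : ℝ) ≠ 0 := Nat.cast_ne_zero.2 (NeZero.ne n)
  have h1 : ∀ i, (t i).elim 0 (fun a => L.missWeight i a w) = ENNReal.ofReal
      ((if (t i).isSome then 1 else 0) - ∑ a, if t i = some a then L.mixWeight w i a else 0) := by
    intro i
    rcases h : t i with _ | a
    · simp
    · simp [missWeight]
  simp only [h1]
  rw [← ENNReal.ofReal_sum_of_nonneg]
  · congr 1
    rw [activeShare, hitShare, ← sub_div, mul_div_cancel₀ _ hn, Finset.sum_sub_distrib]
  · intro i _
    rcases h : t i with _ | a
    · simp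
    · simpa using (L.isWeight_mixWeight w).le_one i a

/-- The loss is at most `n / 12` on success and at most `n` on failure, which has probability at
most `1 / 4`. -/
theorem expect_sum_missWeight_le (alg : Sampler S A) (P : S → A → PMF S) (t : Fin n → Option A)
    (G : Set (MixedPolicy S A)) (hG : 3 / 4 ≤ alg.outputProb P G)
    (hG' : ∀ w ∈ G, activeShare t - hitShare t (L.mixWeight w) ≤ 1 / 12) :
    alg.expect P (fun w => ∑ i, (t i).elim 0 (fun a => L.missWeight i a w)) ≤
      ENNReal.ofReal (n / 3) := by
  have hb : ∀ w, ∑ i, (t i).elim 0 (fun a => L.missWeight i a w) ≤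
      ENNReal.ofReal (n / 12) * 1 + ENNReal.ofReal n * Gᶜ.indicator 1 w := by
    intro w
    rw [sum_missWeight]
    by_cases hw : w ∈ G
    · simp only [Set.mem_compl_iff, hw, not_true, not_false_eq_true, Set.indicator_of_notMem,
        mul_zero, add_zero, mul_one]
      apply ENNReal.ofReal_le_ofReal
      have := mul_le_mul_of_nonneg_left (hG' w hw) (Nat.cast_nonneg (α := ℝ) n)
      linarith
    · have h1 : Gᶜ.indicator (1 : MixedPolicy S A → ENNReal) w = 1 := by simp [hw]
      rw [h1, mul_one, mul_one]
      refine le_add_left (ENNReal.ofReal_le_ofReal ?_)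
      have h2 := (activeShare_mem t).2
      have h3 := (L.shares_nonneg t (L.isWeight_mixWeight w)).2
      exact mul_le_of_le_one_right (Nat.cast_nonneg n) (by linarith)
  have hone := alg.expect_le_one P (F := fun _ => 1) fun _ => le_rfl
  have hsplit : alg.outputProb P G + alg.expect P (Gᶜ.indicator 1) ≤ 1 := by
    rw [Sampler.outputProb_eq_expect, ← alg.expect_add]
    refine alg.expect_le_one P fun w => ?_
    by_cases hw : w ∈ G <;> simp [hw]
  have hquarter : alg.expect P (Gᶜ.indicator 1) ≤ ENNReal.ofReal (1 / 4) := by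
    have h34 : (3 / 4 : ENNReal) = ENNReal.ofReal (3 / 4) := by
      rw [ENNReal.ofReal_div_of_pos (by norm_num)]; simp
    rw [h34] at hG
    have h2 : ENNReal.ofReal (3 / 4) + alg.expect P (Gᶜ.indicator 1) ≤
        ENNReal.ofReal (3 / 4) + ENNReal.ofReal (1 / 4) := by
      rw [← ENNReal.ofReal_add (by norm_num) (by norm_num)]
      norm_num
      refine le_trans ?_ hsplit
      gcongr
    exact (ENNReal.add_le_add_iff_left ENNReal.ofReal_ne_top).1 h2
  calc _ ≤ alg.expect P (fun w => ENNReal.ofReal (n / 12) * 1 +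
        ENNReal.ofReal n * Gᶜ.indicator 1 w) := alg.expect_mono P hb
    _ = ENNReal.ofReal (n / 12) * alg.expect P (fun _ => 1) +
        ENNReal.ofReal n * alg.expect P (Gᶜ.indicator 1) := by
        rw [alg.expect_add, alg.expect_const_mul, alg.expect_const_mul]
    _ ≤ ENNReal.ofReal (n / 12) * 1 + ENNReal.ofReal n * ENNReal.ofReal (1 / 4) := by gcongr
    _ = ENNReal.ofReal (n / 3) := by
        rw [mul_one, ← ENNReal.ofReal_mul (Nat.cast_nonneg n),
          ← ENNReal.ofReal_add (by positivity) (by positivity)]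
        congr 1
        ring

/-- If the hidden actions are found with few samples, then their number is small. -/
theorem le_mul_expectedSamples (alg : Sampler S A) (δ : Shift) {X : ℝ} (hX0 : 0 ≤ X)
    [Nonempty {a // a ≠ L.safe}]
    (hX : ∀ t : Fin n → Option A, (∀ i, t i ≠ some L.safe) →
      alg.expectedSamples (L.kernel (hiddenShift δ t)) ≤ ENNReal.ofReal X)
    (hloss : ∀ t : Fin n → Option A, (∀ i, t i ≠ some L.safe) →
      alg.expect (L.kernel (hiddenShift δ t))
        (fun w => ∑ i, (t i).elim 0 (fun a => L.missWeight i a w)) ≤ ENNReal.ofReal (n / 3)) :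
    n * ((Fintype.card {a // a ≠ L.safe} : ℝ) / 6 - 1) ≤ 32 / 3 * L.p * δ ^ 2 * X := by
  let val : (Fin n → Option {a // a ≠ L.safe}) → Fin n → Option A := fun t i =>
    (t i).map Subtype.val
  have hval : ∀ t i, val t i ≠ some L.safe := by
    intro t i h
    simp only [val, Option.map_eq_some_iff] at h
    obtain ⟨a, -, ha⟩ := h
    exact a.2 ha
  let K : (Fin n → Option {a // a ≠ L.safe}) → S → A → PMF S := fun t =>
    L.kernel (hiddenShift δ (val t))
  have hfinE : ∀ t i a, alg.expect (K t) (L.missWeight i a) ≠ ⊤ := fun t i a =>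
    ne_top_of_le_ne_top ENNReal.one_ne_top (alg.expect_le_one _ (L.missWeight_le_one i a))
  have hsum : ∀ t, ∑ i, ∑ a : {a // a ≠ L.safe}, alg.pairSamples (K t) (L.st i none, a) ≤
      ENNReal.ofReal X := by
    intro t
    refine le_trans ?_ (hX (val t) (hval t))
    rw [Sampler.expectedSamples_eq_tsum, tsum_fintype, ← Fintype.sum_prod_type' (f := fun i
      (a : {a // a ≠ L.safe}) => alg.pairSamples (K t) (L.st i none, a))]
    have hinj : Function.Injective
        (fun y : Fin n × {a // a ≠ L.safe} => (L.st y.1 none, (y.2 : A))) := by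
      rintro ⟨i, a⟩ ⟨j, b⟩ h
      simp only [Prod.mk.injEq, st, EmbeddingLike.apply_eq_iff_eq, Sum.inl.injEq, and_true] at h
      exact Prod.ext h.1 (Subtype.ext h.2)
    rw [← Finset.sum_image (f := fun q => alg.pairSamples (K t) q)
      (g := fun y : Fin n × {a // a ≠ L.safe} => (L.st y.1 none, (y.2 : A))) hinj.injOn]
    exact Finset.sum_le_sum_of_subset (Finset.subset_univ _)
  have hfinN : ∀ t i (a : {a // a ≠ L.safe}), alg.pairSamples (K t) (L.st i none, a) ≠ ⊤ := by
    intro t i a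
    refine ne_top_of_le_ne_top ENNReal.ofReal_ne_top (le_trans ?_ (hsum t))
    refine le_trans ?_ (Finset.single_le_sum (f := fun i => ∑ a : {a // a ≠ L.safe},
      alg.pairSamples (K t) (L.st i none, a)) (fun _ _ => zero_le) (Finset.mem_univ i))
    exact Finset.single_le_sum (f := fun a : {a // a ≠ L.safe} =>
      alg.pairSamples (K t) (L.st i none, a)) (fun _ _ => zero_le) (Finset.mem_univ a)
  have hc : 0 ≤ 16 / 3 * (L.p : ℝ) * (δ : ℝ) ^ 2 := by
    have := L.p.2.1
    positivity
  refine le_mul_of_loss_le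
    (fun t i a => (alg.expect (K t) (L.missWeight i a)).toReal)
    (fun t i a => (alg.pairSamples (K t) (L.st i none, (a : A))).toReal)
    -- Twice the information per sample, by the factor `2` in the testing inequality.
    (c := 32 / 3 * L.p * δ ^ 2) (X := X) (by linarith) (fun _ _ _ => ENNReal.toReal_nonneg)
    ?_ ?_ ?_ ?_
  · intro t i a ht
    have hv : val (Function.update t i (some a)) = Function.update (val t) i (some (a : A)) := by
      funext j
      by_cases hj : j = i
      · subst hj; simp [val]
      · simp [val, hj]
    have h := L.two_mul_expect_le_of_hidden alg δ (val t) i a.2 (by simp [val, ht])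
      (L.missWeight i a) (L.missWeight_le_one i a)
    rw [← hv] at h
    have h1 := hfinE (Function.update t i (some a)) i a
    have h2 := hfinN t i a
    have h3 := ENNReal.toReal_mono (ENNReal.add_ne_top.2 ⟨ENNReal.add_ne_top.2
      ⟨h1, ENNReal.one_ne_top⟩, ENNReal.mul_ne_top ENNReal.ofNat_ne_top
      (ENNReal.mul_ne_top h2 ENNReal.ofReal_ne_top)⟩) h
    rw [ENNReal.toReal_add (ENNReal.add_ne_top.2 ⟨h1, ENNReal.one_ne_top⟩)
      (ENNReal.mul_ne_top ENNReal.ofNat_ne_top (ENNReal.mul_ne_top h2 ENNReal.ofReal_ne_top)),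
      ENNReal.toReal_add h1 ENNReal.one_ne_top, ENNReal.toReal_mul, ENNReal.toReal_mul,
      ENNReal.toReal_mul, ENNReal.toReal_ofReal hc, ENNReal.toReal_ofNat, ENNReal.toReal_one] at h3
    refine h3.trans (le_of_eq ?_)
    simp only [K]
    ring
  · intro t i
    rw [← ENNReal.toReal_sum fun (a : {a // a ≠ L.safe}) _ => hfinE t i (a : A), ← alg.expect_sum]
    refine (ENNReal.ofReal_le_iff_le_toReal ?_).1 ?_
    · rw [alg.expect_sum]
      exact ENNReal.sum_ne_top.2 fun a _ => hfinE t i a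
    · calc ENNReal.ofReal (Fintype.card {a // a ≠ L.safe} - 1)
          = ENNReal.ofReal (Fintype.card {a // a ≠ L.safe} - 1) *
            alg.expect (K t) (fun _ => 1) := by
            -- Runs that never stop count as `0` in `expect`, so almost sure stopping is needed
            -- here; it follows from the finite expected number of samples.
            rw [alg.expect_one, alg.tsum_reachProb_stopProb_eq_one, mul_one]
            exact ne_top_of_le_ne_top ENNReal.ofReal_ne_top (hX _ (hval t))
        _ = alg.expect (K t) (fun _ => ENNReal.ofReal (Fintype.card {a // a ≠ L.safe} - 1) * 1) :=
            (alg.expect_const_mul _ _ _).symm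
        _ ≤ _ := alg.expect_mono _ fun w => by
            rw [mul_one]
            exact L.le_sum_missWeight i w
  · intro t
    have h := ENNReal.toReal_mono ENNReal.ofReal_ne_top (hsum t)
    rw [ENNReal.toReal_ofReal hX0, ENNReal.toReal_sum fun i _ =>
      ENNReal.sum_ne_top.2 fun a _ => hfinN t i a] at h
    simpa only [ENNReal.toReal_sum fun a _ => hfinN t _ a] using h
  · intro t
    have h := ENNReal.toReal_mono ENNReal.ofReal_ne_top (hloss (val t) (hval t))
    rw [ENNReal.toReal_ofReal (by positivity), alg.expect_sum, ENNReal.toReal_sum] at h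
    · refine le_trans (le_of_eq (Finset.sum_congr rfl fun i _ => ?_)) h
      rcases hti : t i with _ | a
      · simp [val, hti, Sampler.expect]
      · simp only [val, hti, Option.map_some, Option.elim]
        rfl
    · intro i _
      refine ne_top_of_le_ne_top ENNReal.one_ne_top (alg.expect_le_one _ fun w => ?_)
      rcases hti : t i with _ | a
      · simp [val, hti]
      · simpa [val, hti] using L.missWeight_le_one i a w

end Layout

end

/-! ### Choice of parameters and conclusion -/

theorem mainTheorem3 :
    ∃ (κ ε₀ : ℝ) (N₀ : ℕ), 0 < κ ∧ 0 < ε₀ ∧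
      ∀ (S A : ℕ) (B H ζ ε : ℝ),
        N₀ ≤ S → N₀ ≤ A → (N₀ : ℝ) ≤ B → (N₀ : ℝ) ≤ H →
        0 < ζ → ζ ≤ 1 → 0 < ε → ε ≤ ε₀ → ε * ζ * B ≤ H →
        ∀ alg : CTask (Fin S) (Fin A) → Sampler (Fin S) (Fin A),
          (∀ M ∈ CAMDP.problemClass (Fin S) (Fin A) B H ζ,
            3 / 4 ≤ (alg M.toCTask).outputProb M.P (M.strictlyOptimal (ε / 24))) →
          ∃ M ∈ CAMDP.problemClass (Fin S) (Fin A) B H ζ,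
            ENNReal.ofReal (κ * (S * A * (B + H) / (ε ^ 2 * ζ ^ 2))) ≤
              (alg M.toCTask).expectedSamples M.P := by
  -- `ε ≤ 1 / 256` gives `δ ≤ 1 / 8`; the bound `64` gives `p < 1` and makes the additive losses in
  -- `A` negligible.
  refine ⟨1 / 10 ^ 9, 1 / 256, 64, by norm_num, by norm_num, ?_⟩
  intro S A B H ζ ε hS hA hB hH hζ hζ1 hε hε' hBH alg halg
  push_cast at hB hH
  have hεζ := mul_pos hε hζ
  have hL : 0 < max B H := lt_max_of_lt_left (by linarith)
  have hL64 : 64 ≤ max B H := le_max_of_le_left hB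
  have hp0 : 0 < 32 / max B H := by positivity
  have hp1 : 32 / max B H < 1 := by rw [div_lt_one hL]; linarith
  let n := S / 4
  let d := S % 4
  have hn1 : 1 ≤ n := by simp only [n]; omega
  have : NeZero n := ⟨by omega⟩
  have hA1 : 1 < A := by omega
  have : NeZero A := ⟨by omega⟩
  let e : Fin S ≃ (Fin n × Option (Fin 3)) ⊕ Fin d := Fintype.equivOfCardEq (by
    simp only [Fintype.card_sum, Fintype.card_prod, Fintype.card_option, Fintype.card_fin, n, d]
    omega)
  let p : unitInterval := ⟨32 / max B H, hp0.le, hp1.le⟩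
  -- Outcome states are absorbing when `B` dominates and return when `H` does; action `0` is the
  -- safe one.
  let L : Layout (Fin S) (Fin A) n d := ⟨e, p, if H ≤ B then 0 else p, 0⟩
  have hLp : (L.p : ℝ) = 32 / max B H := rfl
  let arm : Fin A := ⟨1, hA1⟩
  have harm : arm ≠ L.safe := by
    intro h
    have := congrArg Fin.val h
    simp [arm, L] at this
  have : Nonempty {a // a ≠ L.safe} := ⟨⟨arm, harm⟩⟩
  let δ : Shift := ⟨32 * ε * ζ, by nlinarith, by nlinarith⟩
  have hδ : (δ : ℝ) = 32 * ε * ζ := rfl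
  have hγ : ∃ γ, L.IsFactor γ := by
    by_cases h : H ≤ B
    · exact ⟨1, Or.inl ⟨by simp [L, h], rfl⟩⟩
    · exact ⟨1 / 2, Or.inr ⟨by simp [L, h], rfl⟩⟩
  obtain ⟨γ, hγ⟩ := hγ
  obtain ⟨rv, cv, b, hrv, hcv, htask⟩ := L.exists_task hγ hp0 harm hζ hε hε' δ hδ
  have hmem : ∀ t : Fin n → Option (Fin A), (∀ i, t i ≠ some L.safe) →
      L.camdp rv cv b (Layout.hiddenShift δ t) ∈
        CAMDP.problemClass (Fin S) (Fin A) B H ζ := by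
    intro t ht
    refine L.camdp_mem_problemClass hp0 hp1 rv cv b δ (by rw [hδ]; positivity) ?_ hrv hcv t
      (htask t ht).1
    by_cases h : H ≤ B
    · refine Or.inl ⟨by simp [L, h], ?_, ?_⟩
      · rw [hLp, max_eq_left h, one_div_div]
        linarith
      · rw [hLp, hδ, max_eq_left h, div_div_eq_mul_div]
        linarith
    · refine Or.inr ⟨by simp [L, h], ?_⟩
      rw [hLp, max_eq_right (not_le.1 h).le, div_div_eq_mul_div]
      linarith
  by_contra! hcon
  set X : ℝ := 1 / 10 ^ 9 * (S * A * (B + H) / (ε ^ 2 * ζ ^ 2)) with hX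
  have hX0 : 0 ≤ X := by
    have : 0 ≤ B + H := by linarith
    positivity
  -- The task does not involve `t`, so the same sampler is run on every pattern.
  have key := L.le_mul_expectedSamples (alg (L.task rv cv b)) δ hX0
    (fun t ht => (hcon _ (hmem t ht)).le)
    (fun t ht => L.expect_sum_missWeight_le _ _ t _ (halg _ (hmem t ht)) (htask t ht).2)
  have hcard : (Fintype.card {a // a ≠ L.safe} : ℝ) = A - 1 := by
    rw [Fintype.card_subtype_compl, Fintype.card_subtype_eq, Fintype.card_fin, Nat.cast_sub hA1.le,
      Nat.cast_one]
  have hnS : (S : ℝ) / 8 ≤ n := by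
    have : S ≤ 8 * n := by simp only [n]; omega
    have : (S : ℝ) ≤ 8 * n := by exact_mod_cast this
    linarith
  have hA' : (64 : ℝ) ≤ A := by exact_mod_cast hA
  have hS' : (64 : ℝ) ≤ S := by exact_mod_cast hS
  have hsum : (B + H) / max B H ≤ 2 := by
    rw [div_le_iff₀ hL]
    linarith [le_max_left B H, le_max_right B H]
  have hright : 32 / 3 * (L.p : ℝ) * (δ : ℝ) ^ 2 * X =
      32 * 32 * 1024 / 3 / 10 ^ 9 * (S * A) * ((B + H) / max B H) := by
    rw [hLp, hδ, hX]
    field_simp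
    ring
  rw [hright, hcard] at key
  -- The contradiction is between a lower bound of `S * A / 192` and an upper bound below `S * A /
  -- 1000`.
  have h1 : (S : ℝ) / 8 * (A / 24) ≤ n * (((A : ℝ) - 1) / 6 - 1) := by
    apply mul_le_mul hnS <;> linarith
  have h2 : 32 * 32 * 1024 / 3 / 10 ^ 9 * ((S : ℝ) * A) * ((B + H) / max B H) ≤
      32 * 32 * 1024 / 3 / 10 ^ 9 * (S * A) * 2 := by gcongr
  have h3 : (0 : ℝ) < S * A := by positivity
  nlinarith
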